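/- Let $Q=\begin{pmatrix} q_1 & q\\ \bar q & q_2\end{pmatrix}:\mathbb R\to M_2(\mathbb C)$ be Hermitian, $\pi$-periodic and integrable on $[0,\pi)$, so that $q_1,q_2$ are real valued and $q$ is complex valued. Put $$J=\begin{pmatrix}0&1\\-1&0\end{pmatrix},\quad \sigma_1=\begin{pmatrix}0&1\\1&0\end{pmatrix},\quad \sigma_2=\begin{pmatrix}0&i\\-i&0\end{pmatrix},\quad \sigma_3=\begin{pmatrix}1&0\\0&-1\end{pmatrix},$$ let $\mathbb I$ be the identity matrix, and write $Q=Q_1+Q_2$ with $$Q_1=\operatorname{Re}(q)\,\sigma_1+\tfrac12(q_1-q_2)\,\sigma_3,\qquad Q_2=\tfrac12(q_1+q_2)\,\mathbb I+\operatorname{Im}(q)\,\sigma_2 .$$ For $\lambda\in\mathbb C$ let $\mathbb Y(\lambda,\cdot)$ be the fundamental matrix of $JY'+QY=\lambda Y$ on $\mathbb R$ with $\mathbb Y(\lambda,0)=\mathbb I$ (locally absolutely continuous entries, equation satisfied almost everywhere), and let $\Delta(\lambda)=\operatorname{tr}\mathbb Y(\lambda,\pi)$ be the discriminant. Further let $$R(z)=\exp\Bigl(J\int_0^z\Bigl(Q_2(t)-\tfrac1\pi\int_0^\pi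 Q_2\,d\tau\Bigr)dt\Bigr),\qquad \tilde Q_1(z)=R(z)^{-1}Q_1(z)R(z),\qquad \tilde Q_2(z)=\tfrac1\pi\int_0^\pi Q_2\,dt .$$ An entire function is said to have only double zeros if each of its zeros in $\mathbb C$ has order exactly $2$. Then the following hold. (a) If $Q_1(x+\frac\pi2)=-Q_1(x)$ and $Q_2(x+\frac\pi2)=Q_2(x)$ for almost every $x\in\mathbb R$, then the function $\lambda\mapsto\Delta(\lambda)-2e^{-i\int_0^\pi\operatorname{Im}q\,dt}$ has only double zeros. (b) Conversely, if $\lambda\mapsto\Delta(\lambda)-2e^{-i\int_0^\pi\operatorname{Im}q\,dt}$ has only double zeros, then $\tilde Q_1(x+\frac\pi2)=-\tilde Q_1(x)$ and $\tilde Q_2(x+\frac\pi2)=\tilde Q_2(x)$ for almost every $x\in\mathbb R$. -/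

import Mathlib

open MeasureTheory

namespace SelfAdjointSystem

noncomputable section

/-- The `2 × 2` complex matrices. -/
abbrev M2 : Type := Matrix (Fin 2) (Fin 2) ℂ

/-- The symplectic matrix `J`. -/
def J : M2 := !![0, 1; -1, 0]

/-- The Pauli matrix `σ₁`. -/
def pauli1 : M2 := !![0, 1; 1, 0]

/-- The Pauli matrix `σ₂ = i J` (in this sign convention). -/
def pauli2 : M2 := !![0, Complex.I; -Complex.I, 0]

/-- The Pauli matrix `σ₃`. -/
def pauli3 : M2 := !![1, 0; 0, -1]

/-- Entrywise integral `∫₀ᶻ F(t) dt` of a matrix valued function. -/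
def matIntegral (F : ℝ → M2) (z : ℝ) : M2 :=
  Matrix.of fun i j => ∫ t in (0 : ℝ)..z, F t i j

/-- The component `Q₁ = Re(q) σ₁ + ½ (q₁ - q₂) σ₃` of `Q = (q₁, q; q*, q₂)`, which anticommutes
with `J`. -/
def Q1 (Q : ℝ → M2) (x : ℝ) : M2 :=
  ((Q x 0 1).re : ℂ) • pauli1 + ((Q x 0 0 - Q x 1 1) / 2) • pauli3

/-- The component `Q₂ = ½ (q₁ + q₂) σ₀ + Im(q) σ₂` of `Q = (q₁, q; q*, q₂)`, which commutes
with `J`. -/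
def Q2 (Q : ℝ → M2) (x : ℝ) : M2 :=
  ((Q x 0 0 + Q x 1 1) / 2) • (1 : M2) + ((Q x 0 1).im : ℂ) • pauli2

/-- `Y` is the fundamental matrix of `J Y' + Q Y = lam Y` on `ℝ`, normalised at `0`: its entries are
absolutely continuous on every compact interval, the equation holds almost everywhere, and `Y(0)`
is the identity matrix. -/
structure IsFundamentalMatrix (Q : ℝ → M2) (lam : ℂ) (Y : ℝ → M2) : Prop where
  absolutelyContinuous : ∀ (i j : Fin 2) (a b : ℝ),
    AbsolutelyContinuousOnInterval (fun x => Y x i j) a b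
  equation : ∀ᵐ x : ℝ, ∃ Y' : M2,
    (∀ i j : Fin 2, HasDerivAt (fun t => Y t i j) (Y' i j) x) ∧ J * Y' + Q x * Y x = lam • Y x
  initial : Y 0 = 1

/-- The fundamental matrix `𝕐(lam, ·)` of `J Y' + Q Y = lam Y` with `𝕐(lam, 0) = 𝕀`. For `Q`
integrable on compact intervals there is exactly one function with the defining property, so this
choice selects it. -/
def fundamentalMatrix (Q : ℝ → M2) (lam : ℂ) : ℝ → M2 :=
  Classical.epsilon (IsFundamentalMatrix Q lam)

/-- The discriminant `Δ(lam) = y₁₁(π) + y₂₂(π)`, the trace of the monodromy matrix. -/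
def discriminant (Q : ℝ → M2) (lam : ℂ) : ℂ :=
  (fundamentalMatrix Q lam Real.pi).trace

/-- The mean value `(1/π) ∫₀^π Q₂ dt`. -/
def meanQ2 (Q : ℝ → M2) : M2 :=
  (Real.pi : ℂ)⁻¹ • matIntegral (Q2 Q) Real.pi

/-- The gauge transformation `R(z) = exp (J ∫₀ᶻ (Q₂ - (1/π) ∫₀^π Q₂ dτ) dt)`. -/
def R (Q : ℝ → M2) (z : ℝ) : M2 :=
  NormedSpace.exp (J * matIntegral (fun t => Q2 Q t - meanQ2 Q) z)

/-- `Q̃₁(z) = R(z)⁻¹ Q₁(z) R(z)`. -/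
def Q1tilde (Q : ℝ → M2) (z : ℝ) : M2 := (R Q z)⁻¹ * Q1 Q z * R Q z

/-- `Q̃₂(z) = (1/π) ∫₀^π Q₂ dt`, a constant function of `z`. -/
def Q2tilde (Q : ℝ → M2) (_z : ℝ) : M2 := meanQ2 Q

/-- Every complex zero of `f` is a zero of order exactly two. -/
def OnlyDoubleZeros (f : ℂ → ℂ) : Prop :=
  ∀ lam : ℂ, f lam = 0 → analyticOrderAt f lam = 2

end

end SelfAdjointSystem

/-!
The matrix `Q₂` commutes with `J` and `Q₁` anticommutes with it. Hence the gauge transformation `R`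
removes `Q₂` up to its mean: `Δ(lam) = e^{-i ∫ Im q} D(lam - c)`, where `c` is the mean of
`(q₁ + q₂) / 2` and `D` is the discriminant over `[0, 2l]`, `l = π / 2`, of the Dirac system
`J Y' + V Y = lam Y` with the real, symmetric, trace free potential `V = Q̃₁`. Both claims concern
the zeros of `D - 2`. Let `Φ` be the fundamental matrix of this system.

If `V(x + l) = -V(x)`, then `J Φ(x + l) = Φ(x) J Φ(l)`, so that `D - 2 = (i tr (J Φ(l)))²`. At the
zeros, which are real by self-adjointness, the derivative of `tr (J Φ(l))` in `lam` is a pairing of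
a definite matrix with the Gram matrix of the columns of `Φ`, hence does not vanish.

Conversely, at a double zero of `D - 2` the same pairing forces `Φ(2l) = 1`, so the transfer
matrices over `[0, l]` and `[l, 2l]` are inverse to each other. Measure the failure of this for
arbitrary `lam` by a matrix, and let `n` be a component of it transversal to `J`. Then
`n² / (D - 2)` is entire, and by the Riemann–Lebesgue lemma it tends to zero along circles midway
between the zeros of `sin² (lam l)`. It follows that `n = 0`. This holds for all translates of `V`,
and differentiating the resulting identity with respect to the translation gives
`V(x + l) = -V(x)`.
-/

namespace SelfAdjointSystem

open Set Filter Topology intervalIntegral Matrix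

noncomputable section

section Antiderivative

variable {E : Type*} [NormedAddCommGroup E] [NormedSpace ℝ E]

/-- `F` is a locally absolutely continuous antiderivative of the locally integrable `f`, encoded by
the fundamental theorem of calculus. -/
structure IsIntegralOf (F f : ℝ → E) : Prop where
  intervalIntegrable : ∀ a b : ℝ, IntervalIntegrable f volume a b
  eq_add : ∀ x, F x = F 0 + ∫ t in (0 : ℝ)..x, f t

theorem absolutelyContinuousOnInterval_of_dist_le {X Y : Type*} [PseudoMetricSpace X]
    [PseudoMetricSpace Y] {F : ℝ → X} {G : ℝ → Y} {a b C : ℝ}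
    (hG : AbsolutelyContinuousOnInterval G a b)
    (h : ∀ x ∈ uIcc a b, ∀ y ∈ uIcc a b, dist (F x) (F y) ≤ C * dist (G x) (G y)) :
    AbsolutelyContinuousOnInterval F a b := by
  have hG' : Tendsto _ _ _ := hG
  have hCG := hG'.const_mul C
  rw [mul_zero] at hCG
  refine squeeze_zero' (.of_forall fun _ => Finset.sum_nonneg fun _ _ => dist_nonneg) ?_ hCG
  filter_upwards [mem_inf_of_right (mem_principal_self _)] with I hI
  rw [Finset.mul_sum]
  exact Finset.sum_le_sum fun i hi => h _ (hI.1 i hi).1 _ (hI.1 i hi).2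

namespace IsIntegralOf

variable {F G f g : ℝ → E}

theorem sub_eq (h : IsIntegralOf F f) (a b : ℝ) : F b - F a = ∫ t in a..b, f t := by
  rw [h.eq_add b, h.eq_add a, add_sub_add_left_eq_sub,
    integral_interval_sub_left (h.intervalIntegrable _ _) (h.intervalIntegrable _ _)]

theorem const_add_integral (hf : ∀ a b : ℝ, IntervalIntegrable f volume a b) (c : E) :
    IsIntegralOf (fun x => c + ∫ t in (0 : ℝ)..x, f t) f :=
  ⟨hf, fun x => by simp⟩

theorem integral (hf : ∀ a b : ℝ, IntervalIntegrable f volume a b) :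
    IsIntegralOf (fun x => ∫ t in (0 : ℝ)..x, f t) f := by
  simpa only [zero_add] using const_add_integral hf 0

theorem absolutelyContinuousOnInterval (h : IsIntegralOf F f) (a b : ℝ) :
    AbsolutelyContinuousOnInterval F a b := by
  have hn : ∀ a b : ℝ, IntervalIntegrable (fun t => ‖f t‖) volume a b :=
    fun a b => (h.intervalIntegrable a b).norm
  refine absolutelyContinuousOnInterval_of_dist_le (C := 1)
    ((hn a b).absolutelyContinuousOnInterval_intervalIntegral (c := a) left_mem_uIcc)
    fun x _ y _ => ?_
  rw [one_mul, dist_comm, dist_eq_norm, h.sub_eq, dist_comm, Real.dist_eq,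
    integral_interval_sub_left (hn _ _) (hn _ _)]
  exact norm_integral_le_abs_integral_norm

theorem continuous (h : IsIntegralOf F f) : Continuous F := by
  rw [show F = fun x => F 0 + ∫ t in (0 : ℝ)..x, f t from funext h.eq_add]
  exact continuous_const.add (continuous_primitive h.intervalIntegrable 0)

theorem ae_hasDerivAt [CompleteSpace E] (h : IsIntegralOf F f) :
    ∀ᵐ x, HasDerivAt F (f x) x := by
  have hl : LocallyIntegrable f volume := fun x =>
    ⟨Icc (x - 1) (x + 1), Icc_mem_nhds (by linarith) (by linarith),
      (intervalIntegrable_iff_integrableOn_Icc_of_le (by linarith)).1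
        (h.intervalIntegrable (x - 1) (x + 1))⟩
  filter_upwards [LocallyIntegrable.ae_hasDerivAt_integral hl] with x hx
  have := (hx 0).const_add (F 0)
  rwa [← funext h.eq_add] at this

theorem of_absolutelyContinuous [CompleteSpace E]
    (hac : ∀ a b : ℝ, AbsolutelyContinuousOnInterval F a b)
    (hd : ∀ᵐ x, HasDerivAt F (f x) x) (hi : ∀ a b : ℝ, IntervalIntegrable f volume a b) :
    IsIntegralOf F f := by
  refine ⟨hi, fun x => ?_⟩
  have hI := const_add_integral hi (F 0)
  have hac' := (hac 0 x).sub (hI.absolutelyContinuousOnInterval 0 x)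
  obtain ⟨C, hC⟩ := hac'.const_of_ae_hasDerivAt_zero <| by
    filter_upwards [hd, hI.ae_hasDerivAt] with y h1 h2 _
    rw [← sub_self (f y)]
    exact h1.sub h2
  have h0 := hC 0 left_mem_uIcc
  have hx := hC x right_mem_uIcc
  simp only [Pi.sub_apply, integral_same, add_zero, sub_self] at h0 hx
  exact sub_eq_zero.1 (hx.trans h0.symm)

theorem congr_ae (h : IsIntegralOf F f) (hfg : ∀ᵐ x, f x = g x) : IsIntegralOf F g := by
  refine ⟨fun a b => (h.intervalIntegrable a b).congr_ae (ae_restrict_of_ae hfg), fun x => ?_⟩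
  rw [h.eq_add x, intervalIntegral.integral_congr_ae (g := g)]
  filter_upwards [hfg] with x hx _ using hx

theorem ae_eq [CompleteSpace E] (hf : IsIntegralOf F f) (hg : IsIntegralOf F g) :
    ∀ᵐ x, f x = g x := by
  filter_upwards [hf.ae_hasDerivAt, hg.ae_hasDerivAt] with x h1 h2 using h1.unique h2

theorem of_hasDerivAt [CompleteSpace E] (hd : ∀ x, HasDerivAt F (f x) x) (hf : Continuous f) :
    IsIntegralOf F f := by
  refine ⟨fun a b => hf.intervalIntegrable a b, fun x => ?_⟩
  rw [integral_eq_sub_of_hasDerivAt (fun x _ => hd x) (hf.intervalIntegrable 0 x)]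
  abel

theorem add (hF : IsIntegralOf F f) (hG : IsIntegralOf G g) :
    IsIntegralOf (fun x => F x + G x) (fun x => f x + g x) := by
  refine ⟨fun a b => (hF.intervalIntegrable a b).add (hG.intervalIntegrable a b), fun x => ?_⟩
  rw [integral_add (hF.intervalIntegrable 0 x) (hG.intervalIntegrable 0 x), hF.eq_add x,
    hG.eq_add x]
  abel

theorem neg (h : IsIntegralOf F f) : IsIntegralOf (fun x => -F x) (fun x => -f x) := by
  refine ⟨fun a b => (h.intervalIntegrable a b).neg, fun x => ?_⟩
  rw [intervalIntegral.integral_neg, h.eq_add x, neg_add]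

theorem sub (hF : IsIntegralOf F f) (hG : IsIntegralOf G g) :
    IsIntegralOf (fun x => F x - G x) (fun x => f x - g x) := by
  simpa only [sub_eq_add_neg] using hF.add hG.neg

theorem const (c : E) : IsIntegralOf (fun _ => c) (fun _ => (0 : E)) :=
  ⟨fun _ _ => intervalIntegrable_const, fun x => by simp⟩

theorem comp_add_right (h : IsIntegralOf F f) (c : ℝ) :
    IsIntegralOf (fun x => F (x + c)) (fun x => f (x + c)) := by
  refine ⟨fun a b => by simpa using (h.intervalIntegrable (a + c) (b + c)).comp_add_right c,
    fun x => ?_⟩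
  rw [integral_comp_add_right (fun t => f t) c, ← h.sub_eq (0 + c) (x + c)]
  abel

theorem comp_neg (h : IsIntegralOf F f) : IsIntegralOf (fun x => F (-x)) (fun x => -f (-x)) := by
  have hi : ∀ a b : ℝ, IntervalIntegrable (fun x => f (-x)) volume a b := fun a b => by
    simpa using (h.intervalIntegrable (-a) (-b)).comp_sub_left 0
  refine ⟨fun a b => (hi a b).neg, fun x => ?_⟩
  rw [intervalIntegral.integral_neg, intervalIntegral.integral_comp_neg, ← h.sub_eq, neg_zero]
  abel

variable {E' : Type*} [NormedAddCommGroup E'] [NormedSpace ℝ E'] [CompleteSpace E]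
  [CompleteSpace E']

theorem clm_comp (L : E →L[ℝ] E') (h : IsIntegralOf F f) :
    IsIntegralOf (fun x => L (F x)) (fun x => L (f x)) := by
  refine ⟨fun a b => ⟨L.integrable_comp (h.intervalIntegrable a b).1,
    L.integrable_comp (h.intervalIntegrable a b).2⟩, fun x => ?_⟩
  rw [L.intervalIntegral_comp_comm (h.intervalIntegrable 0 x), ← map_add, ← h.eq_add x]

theorem prodMk {H h : ℝ → E'} (hF : IsIntegralOf F f) (hH : IsIntegralOf H h) :
    IsIntegralOf (fun x => (F x, H x)) (fun x => (f x, h x)) := by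
  simpa using (hF.clm_comp (.inl ℝ E E')).add (hH.clm_comp (.inr ℝ E E'))

theorem comp_hasFDerivAt {ψ : E → E'} {ψ' : E → E →L[ℝ] E'}
    (hψ : ∀ y, HasFDerivAt ψ (ψ' y) y) (hψ' : Continuous ψ') (h : IsIntegralOf F f) :
    IsIntegralOf (fun x => ψ (F x)) (fun x => ψ' (F x) (f x)) := by
  have hc : ∀ a b : ℝ, IsCompact (F '' uIcc a b) := fun a b =>
    isCompact_uIcc.image h.continuous
  refine .of_absolutelyContinuous (fun a b => ?_) ?_ fun a b => ?_
  · have hloc := (contDiff_one_iff_hasFDerivAt.2 ⟨ψ', hψ', hψ⟩).locallyLipschitz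
    obtain ⟨K, hK⟩ := hloc.locallyLipschitzOn.exists_lipschitzOnWith_of_compact (hc a b)
    exact absolutelyContinuousOnInterval_of_dist_le (h.absolutelyContinuousOnInterval a b)
      fun x hx y hy => hK.dist_le_mul _ (mem_image_of_mem F hx) _ (mem_image_of_mem F hy)
  · filter_upwards [h.ae_hasDerivAt] with x hx using (hψ _).comp_hasDerivAt x hx
  · obtain ⟨C, hC⟩ := (hc a b).exists_bound_of_continuousOn hψ'.continuousOn
    have hmeas : AEStronglyMeasurable (fun x => ψ' (F x) (f x)) (volume.restrict (uIoc a b)) :=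
      (ContinuousLinearMap.id ℝ (E →L[ℝ] E')).aestronglyMeasurable_comp₂
        (hψ'.comp h.continuous).aestronglyMeasurable
        (h.intervalIntegrable a b).def'.aestronglyMeasurable
    refine ((h.intervalIntegrable a b).norm.const_mul C).mono_fun hmeas ?_
    filter_upwards [ae_restrict_mem measurableSet_uIoc] with x hx
    have hCx := hC _ (mem_image_of_mem F (uIoc_subset_uIcc hx))
    rw [Real.norm_of_nonneg (mul_nonneg ((norm_nonneg _).trans hCx) (norm_nonneg _))]
    exact (ψ' (F x)).le_of_opNorm_le hCx (f x)

theorem comp_hasDerivAt {ψ ψ' : ℝ → E} {α a : ℝ → ℝ} (hψ : ∀ y, HasDerivAt ψ (ψ' y) y)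
    (hψ' : Continuous ψ') (h : IsIntegralOf α a) :
    IsIntegralOf (fun x => ψ (α x)) (fun x => a x • ψ' (α x)) := by
  simpa using h.comp_hasFDerivAt (fun y => (hψ y).hasFDerivAt)
    ((ContinuousLinearMap.smulRightL ℝ ℝ E 1).continuous.comp hψ')

section NormedAlgebra

variable {𝔸 : Type*} [NormedRing 𝔸] [NormedAlgebra ℝ 𝔸] [CompleteSpace 𝔸] {F G f g : ℝ → 𝔸}

theorem mul (hF : IsIntegralOf F f) (hG : IsIntegralOf G g) :
    IsIntegralOf (fun x => F x * G x) (fun x => f x * G x + F x * g x) := by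
  have h := (hF.prodMk hG).comp_hasFDerivAt
    (fun p => (ContinuousLinearMap.mul ℝ 𝔸).isBoundedBilinearMap.hasFDerivAt p)
    (ContinuousLinearMap.mul ℝ 𝔸).isBoundedBilinearMap.isBoundedLinearMap_deriv.continuous
  simpa [add_comm] using h

theorem mul_const (h : IsIntegralOf F f) (c : 𝔸) :
    IsIntegralOf (fun x => F x * c) fun x => f x * c := by
  simpa using h.mul (.const c)

theorem const_mul (h : IsIntegralOf F f) (c : 𝔸) :
    IsIntegralOf (fun x => c * F x) fun x => c * f x := by
  simpa using (IsIntegralOf.const c).mul h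

end NormedAlgebra

end IsIntegralOf

end Antiderivative

section LinearODE

theorem le_mul_exp_of_le_add_integral {a w : ℝ → ℝ} {ε l : ℝ}
    (ha : ∀ s t : ℝ, IntervalIntegrable a volume s t) (ha0 : ∀ t, 0 ≤ a t) (hw : Continuous w)
    (h : ∀ x ∈ Icc 0 l, w x ≤ ε + ∫ t in (0 : ℝ)..x, a t * w t) :
    ∀ x ∈ Icc 0 l, w x ≤ ε * Real.exp (∫ t in (0 : ℝ)..x, a t) := by
  set α : ℝ → ℝ := fun x => ∫ t in (0 : ℝ)..x, a t with hα
  set u : ℝ → ℝ := fun x => ε + ∫ t in (0 : ℝ)..x, a t * w t with hu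
  have hu' : IsIntegralOf u fun t => a t * w t :=
    .const_add_integral (fun s t => (ha s t).mul_continuousOn hw.continuousOn) ε
  have hexp : ∀ y, HasDerivAt (fun y : ℝ => Real.exp (-y)) (-Real.exp (-y)) y := fun y => by
    simpa using (hasDerivAt_neg y).exp
  have hφ := hu'.mul ((IsIntegralOf.integral ha).comp_hasDerivAt hexp (by fun_prop))
  intro x hx
  have hle : u x * Real.exp (-α x) ≤ ε := by
    have h0 : u 0 * Real.exp (-α 0) = ε := by simp [hu, hα]
    refine sub_nonpos.1 ((h0 ▸ hφ.sub_eq 0 x).trans_le ?_)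
    rw [← neg_nonneg, ← intervalIntegral.integral_neg]
    refine intervalIntegral.integral_nonneg hx.1 fun t ht => ?_
    have hwu : 0 ≤ u t - w t := sub_nonneg.2 (h t ⟨ht.1, ht.2.trans hx.2⟩)
    have : 0 ≤ a t * Real.exp (-α t) * (u t - w t) :=
      mul_nonneg (mul_nonneg (ha0 t) (Real.exp_pos _).le) hwu
    simp only [smul_eq_mul]
    linarith
  calc w x ≤ u x := h x hx
    _ = u x * Real.exp (-α x) * Real.exp (α x) := by
      rw [mul_assoc, ← Real.exp_add, neg_add_cancel, Real.exp_zero, mul_one]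
    _ ≤ ε * Real.exp (α x) := by gcongr

theorem abs_integral_norm_comp_neg {E : Type*} [NormedAddCommGroup E] (A : ℝ → E) (x : ℝ) :
    |∫ t in (0 : ℝ)..x, ‖-A (-t)‖| = |∫ t in (0 : ℝ)..(-x), ‖A t‖| := by
  simp only [norm_neg]
  rw [intervalIntegral.integral_comp_neg (fun t => ‖A t‖), neg_zero, integral_symm, abs_neg]

variable {𝔸 : Type*} [NormedRing 𝔸] [NormedAlgebra ℝ 𝔸] {A : ℝ → 𝔸}

theorem IsIntegralOf.norm_le_of_mul {Y : ℝ → 𝔸}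
    (hA : ∀ s t : ℝ, IntervalIntegrable A volume s t)
    (hY : IsIntegralOf Y fun t => A t * Y t) (x : ℝ) :
    ‖Y x‖ ≤ ‖Y 0‖ * Real.exp |∫ t in (0 : ℝ)..x, ‖A t‖| := by
  wlog hx : 0 ≤ x generalizing A Y x
  · have hA' : ∀ s t : ℝ, IntervalIntegrable (fun t => -A (-t)) volume s t :=
      ((IsIntegralOf.integral hA).comp_neg).intervalIntegrable
    have hY' : IsIntegralOf (fun x => Y (-x)) fun t => -A (-t) * Y (-t) := by
      simpa only [neg_mul] using hY.comp_neg
    have := this hA' hY' (-x) (by linarith)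
    rwa [abs_integral_norm_comp_neg, neg_neg, neg_zero] at this
  refine (le_mul_exp_of_le_add_integral (ε := ‖Y 0‖) (l := x) (fun s t => (hA s t).norm)
    (fun t => norm_nonneg _) hY.continuous.norm (fun y hy => ?_) x ⟨hx, le_rfl⟩).trans ?_
  · rw [hY.eq_add y]
    refine (norm_add_le _ _).trans (add_le_add_right ?_ _)
    exact intervalIntegral.norm_integral_le_of_norm_le hy.1
      (Eventually.of_forall fun t _ => norm_mul_le _ _)
      ((hA 0 y).norm.mul_continuousOn hY.continuous.norm.continuousOn)
  · gcongr
    exact le_abs_self _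

theorem IsIntegralOf.eq_of_mul {Y Z : ℝ → 𝔸} (hA : ∀ s t : ℝ, IntervalIntegrable A volume s t)
    (hY : IsIntegralOf Y fun t => A t * Y t) (hZ : IsIntegralOf Z fun t => A t * Z t)
    (h0 : Y 0 = Z 0) : Y = Z := by
  have hYZ : IsIntegralOf (fun x => Y x - Z x) fun t => A t * (Y t - Z t) := by
    simpa only [mul_sub] using hY.sub hZ
  funext x
  have := hYZ.norm_le_of_mul hA x
  rw [h0, sub_self, norm_zero, zero_mul] at this
  exact sub_eq_zero.1 (norm_le_zero_iff.1 this)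

/-- The terms of the Peano–Baker series of `Y' = A Y`, `Y 0 = 1`. -/
def peanoBaker (A : ℝ → 𝔸) : ℕ → ℝ → 𝔸
  | 0 => fun _ => 1
  | n + 1 => fun x => ∫ t in (0 : ℝ)..x, A t * peanoBaker A n t

theorem peanoBaker_neg (n : ℕ) (x : ℝ) :
    peanoBaker A n (-x) = peanoBaker (fun t => -A (-t)) n x := by
  induction n generalizing x with
  | zero => rfl
  | succ n ih =>
    simp only [peanoBaker, ← ih, neg_mul]
    rw [intervalIntegral.integral_neg,
      intervalIntegral.integral_comp_neg (fun t => A t * peanoBaker A n t), neg_zero,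
      integral_symm]

theorem continuous_peanoBaker (hA : ∀ s t : ℝ, IntervalIntegrable A volume s t) (n : ℕ) :
    Continuous (peanoBaker A n) := by
  induction n with
  | zero => exact continuous_const
  | succ n ih => exact continuous_primitive (fun s t => (hA s t).mul_continuousOn ih.continuousOn) 0

theorem IsIntegralOf.pow_div_factorial {α a : ℝ → ℝ} (h : IsIntegralOf α a) (n : ℕ) :
    IsIntegralOf (fun x => α x ^ (n + 1) / (n + 1).factorial)
      (fun x => a x * (α x ^ n / n.factorial)) := by
  refine h.comp_hasDerivAt (ψ := fun y => y ^ (n + 1) / (n + 1).factorial)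
    (ψ' := fun y => y ^ n / n.factorial) (fun y => ?_) (by fun_prop)
  refine ((hasDerivAt_pow (n + 1) y).div_const _).congr_deriv ?_
  rw [Nat.factorial_succ, Nat.add_sub_cancel]
  push_cast
  field_simp

theorem norm_peanoBaker_le (hA : ∀ s t : ℝ, IntervalIntegrable A volume s t) (n : ℕ) (x : ℝ) :
    ‖peanoBaker A n x‖ ≤ ‖(1 : 𝔸)‖ * (|∫ t in (0 : ℝ)..x, ‖A t‖| ^ n / n.factorial) := by
  wlog hx : 0 ≤ x generalizing A x
  · have := this ((IsIntegralOf.integral hA).comp_neg).intervalIntegrable (-x) (by linarith)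
    rwa [← peanoBaker_neg, abs_integral_norm_comp_neg, neg_neg] at this
  have hI := IsIntegralOf.integral fun s t => (hA s t).norm
  rw [abs_of_nonneg (integral_nonneg hx fun _ _ => norm_nonneg _)]
  induction n generalizing x with
  | zero => simp [peanoBaker]
  | succ n ih =>
    have hint := (hI.pow_div_factorial n).intervalIntegrable 0 x
    calc ‖∫ t in (0 : ℝ)..x, A t * peanoBaker A n t‖
        ≤ ∫ t in (0 : ℝ)..x,
          ‖(1 : 𝔸)‖ * (‖A t‖ * ((∫ s in (0 : ℝ)..t, ‖A s‖) ^ n / n.factorial)) := by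
          refine norm_integral_le_of_norm_le hx (.of_forall fun t ht => ?_) (hint.const_mul _)
          refine (norm_mul_le _ _).trans ?_
          rw [mul_left_comm]
          exact mul_le_mul_of_nonneg_left (ih t ht.1.le) (norm_nonneg _)
      _ = _ := by
          rw [intervalIntegral.integral_const_mul, ← (hI.pow_div_factorial n).sub_eq 0 x]
          simp

theorem norm_peanoBaker_le_of_mem_Icc (hA : ∀ s t : ℝ, IntervalIntegrable A volume s t) (n : ℕ)
    {l x : ℝ} (hx : x ∈ Icc (-l) l) :
    ‖peanoBaker A n x‖ ≤ ‖(1 : 𝔸)‖ * (|∫ t in (-l)..l, ‖A t‖| ^ n / n.factorial) := by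
  refine (norm_peanoBaker_le hA n x).trans ?_
  have hl : -l ≤ l := hx.1.trans hx.2
  have hsub : uIoc 0 x ⊆ uIoc (-l) l := by
    rw [uIoc_of_le hl]
    exact Ioc_subset_Ioc (le_min (by linarith) hx.1) (max_le (by linarith) hx.2)
  gcongr ‖(1 : 𝔸)‖ * (?_ ^ n / n.factorial)
  exact abs_integral_mono_interval hsub (.of_forall fun _ => norm_nonneg _) (hA _ _).norm

variable [CompleteSpace 𝔸]

theorem continuous_tsum_peanoBaker (hA : ∀ s t : ℝ, IntervalIntegrable A volume s t) :
    Continuous fun x => ∑' n, peanoBaker A n x := by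
  refine continuous_iff_continuousAt.2 fun x => ?_
  have hmem : Icc (-(|x| + 1)) (|x| + 1) ∈ 𝓝 x :=
    Icc_mem_nhds (by linarith [neg_abs_le x]) (by linarith [le_abs_self x])
  exact (continuousOn_tsum (fun n => (continuous_peanoBaker hA n).continuousOn)
    ((Real.summable_pow_div_factorial _).mul_left ‖(1 : 𝔸)‖)
    fun n y hy => norm_peanoBaker_le_of_mem_Icc hA n hy).continuousAt hmem

theorem hasSum_peanoBaker (hA : ∀ s t : ℝ, IntervalIntegrable A volume s t) (x : ℝ) :
    HasSum (fun n => peanoBaker A n x) (∑' n, peanoBaker A n x) :=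
  (Summable.of_norm_bounded ((Real.summable_pow_div_factorial _).mul_left _)
    fun n => norm_peanoBaker_le hA n x).hasSum

theorem tsum_peanoBaker_eq (hA : ∀ s t : ℝ, IntervalIntegrable A volume s t) (x : ℝ) :
    ∑' n, peanoBaker A n x = 1 + ∫ t in (0 : ℝ)..x, A t * ∑' n, peanoBaker A n t := by
  rw [(hasSum_peanoBaker hA x).summable.tsum_eq_zero_add]
  congr 1
  set M := |∫ t in (-|x|)..|x|, ‖A t‖|
  have hM : ∀ t ∈ uIoc 0 x, ∀ n,
      ‖A t * peanoBaker A n t‖ ≤ ‖A t‖ * (‖(1 : 𝔸)‖ * (M ^ n / n.factorial)) := fun t ht n => by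
    have ht' : |t| ≤ |x| := by
      simpa using abs_sub_left_of_mem_uIcc (uIoc_subset_uIcc ht)
    exact (norm_mul_le _ _).trans (mul_le_mul_of_nonneg_left
      (norm_peanoBaker_le_of_mem_Icc hA n (abs_le.1 ht')) (norm_nonneg _))
  refine (intervalIntegral.hasSum_integral_of_dominated_convergence
    (F := fun n t => A t * peanoBaker A n t)
    (fun n t => ‖A t‖ * (‖(1 : 𝔸)‖ * (M ^ n / n.factorial))) (fun n => ?_)
    (fun n => .of_forall fun t ht => hM t ht n)
    (.of_forall fun t _ => ((Real.summable_pow_div_factorial M).mul_left _).mul_left _) ?_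
    (.of_forall fun t _ => (hasSum_peanoBaker hA t).mul_left (A t))).tsum_eq
  · exact ((hA 0 x).mul_continuousOn (continuous_peanoBaker hA n).continuousOn).def'.1
  · simp only [tsum_mul_left]
    exact (hA 0 x).norm.mul_const _

theorem exists_isIntegralOf_mul (hA : ∀ s t : ℝ, IntervalIntegrable A volume s t) :
    ∃ Y : ℝ → 𝔸, Y 0 = 1 ∧ IsIntegralOf Y fun t => A t * Y t := by
  have h0 : ∑' n, peanoBaker A n 0 = 1 := by rw [tsum_peanoBaker_eq hA]; simp
  refine ⟨fun x => ∑' n, peanoBaker A n x, h0, fun a b =>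
    (hA a b).mul_continuousOn (continuous_tsum_peanoBaker hA).continuousOn, fun x => ?_⟩
  rw [h0, ← tsum_peanoBaker_eq hA]

end LinearODE

attribute [local instance] Matrix.linftyOpNormedRing Matrix.linftyOpNormedAlgebra

/-- The topology of the operator norm on the `2 × 2` matrices; like the next two abbreviations it
is a local instance, by which every later notion refers to this one norm. -/
abbrev normTopology : TopologicalSpace M2 :=
  PseudoMetricSpace.toUniformSpace.toTopologicalSpace

/-- The `2 × 2` complex matrices as a real normed algebra. -/
abbrev normedAlgebraReal : NormedAlgebra ℝ M2 := Matrix.linftyOpNormedAlgebra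

/-- The `2 × 2` complex matrices as a real normed space. -/
abbrev normedSpaceReal : NormedSpace ℝ M2 := normedAlgebraReal.toNormedSpace

attribute [local instance] normTopology normedAlgebraReal normedSpaceReal

section MatrixNorm

theorem norm_le_of_row_sums_le {A : M2} {c : ℝ} (h : ∀ i, ‖A i 0‖ + ‖A i 1‖ ≤ c) : ‖A‖ ≤ c := by
  have hc : 0 ≤ c := (add_nonneg (norm_nonneg _) (norm_nonneg _)).trans (h 0)
  lift c to NNReal using hc
  rw [Matrix.linfty_opNorm_def, NNReal.coe_le_coe]
  refine Finset.sup_le fun i _ => ?_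
  rw [Fin.sum_univ_two]
  exact_mod_cast h i

theorem norm_J_le_one : ‖J‖ ≤ 1 :=
  norm_le_of_row_sums_le fun i => by fin_cases i <;> simp [J]

theorem IsIntegralOf.linearMap_comp {E E' : Type*} [NormedAddCommGroup E] [NormedSpace ℝ E]
    [FiniteDimensional ℝ E] [NormedAddCommGroup E'] [NormedSpace ℝ E'] [CompleteSpace E']
    {F f : ℝ → E} (h : IsIntegralOf F f) (L : E →ₗ[ℝ] E') :
    IsIntegralOf (fun x => L (F x)) fun x => L (f x) :=
  have := FiniteDimensional.complete ℝ E
  h.clm_comp (LinearMap.toContinuousLinearMap L)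

theorem isIntegralOf_iff_entry {F f : ℝ → M2} :
    IsIntegralOf F f ↔ ∀ i j, IsIntegralOf (fun x => F x i j) fun x => f x i j := by
  refine ⟨fun h i j => h.linearMap_comp (Matrix.entryLinearMap ℝ ℂ i j), fun h => ?_⟩
  have single (i j : Fin 2) : IsIntegralOf (fun x => Matrix.single i j (F x i j))
      fun x => Matrix.single i j (f x i j) := (h i j).linearMap_comp (Matrix.singleLinearMap ℝ i j)
  have hs := ((single 0 0).add (single 0 1)).add ((single 1 0).add (single 1 1))
  convert hs using 2 with x x
  · conv_lhs => rw [Matrix.matrix_eq_sum_single (F x)]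
    simp [Fin.sum_univ_two]
  · conv_lhs => rw [Matrix.matrix_eq_sum_single (f x)]
    simp [Fin.sum_univ_two]

theorem intervalIntegrable_of_entry {f : ℝ → M2}
    (h : ∀ i j, ∀ a b : ℝ, IntervalIntegrable (fun x => f x i j) volume a b) (a b : ℝ) :
    IntervalIntegrable f volume a b :=
  (isIntegralOf_iff_entry (F := fun x => Matrix.of fun i j => ∫ t in (0 : ℝ)..x, f t i j).2
    fun i j => .integral (h i j)).intervalIntegrable a b

end MatrixNorm

section Adjugate

theorem J_mul_J : J * J = -1 := by
  ext i j
  fin_cases i <;> fin_cases j <;> simp [J]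

theorem trace_J : J.trace = 0 := by simp [J, trace_fin_two]

theorem conjTranspose_J : Jᴴ = -J := by
  ext i j
  fin_cases i <;> fin_cases j <;> simp [J]

theorem adjugate_eq_trace_smul_one_sub (A : M2) : A.adjugate = A.trace • 1 - A := by
  rw [adjugate_fin_two, trace_fin_two]
  ext i j
  fin_cases i <;> fin_cases j <;> simp

theorem adjugate_mul_J (A : M2) : A.adjugate * J = J * Aᵀ := by
  rw [adjugate_fin_two]
  ext i j
  fin_cases i <;> fin_cases j <;> simp [J, Matrix.mul_apply, Fin.sum_univ_two]

theorem J_mul_adjugate (A : M2) : J * A.adjugate = Aᵀ * J := by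
  rw [adjugate_fin_two]
  ext i j
  fin_cases i <;> fin_cases j <;> simp [J, Matrix.mul_apply, Fin.sum_univ_two]

theorem J_mul_mul_J (A : M2) : J * A * J = -Aᵀ.adjugate := by
  rw [← transpose_transpose A, ← adjugate_mul_J, mul_assoc, J_mul_J, mul_neg_one,
    transpose_transpose]

theorem trace_J_mul_transpose_mul_self (A : M2) : (J * (Aᵀ * A)).trace = 0 := by
  simp only [J, trace_fin_two, Matrix.mul_apply, Fin.sum_univ_two, transpose_apply, of_apply,
    cons_val', cons_val_zero, cons_val_one, cons_val_fin_one]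
  ring

theorem det_sub_one (A : M2) : (A - 1).det = A.det - A.trace + 1 := by
  simp only [det_fin_two, trace_fin_two, Matrix.sub_apply, one_apply_eq,
    one_apply_ne (zero_ne_one' (Fin 2)), one_apply_ne (zero_ne_one' (Fin 2)).symm]
  ring

theorem IsIntegralOf.adjugate {F f : ℝ → M2} (h : IsIntegralOf F f) :
    IsIntegralOf (fun x => (F x).adjugate) fun x => (f x).adjugate := by
  simp only [adjugate_eq_trace_smul_one_sub]
  exact (h.linearMap_comp ((Matrix.traceLinearMap (Fin 2) ℝ ℂ).smulRight (1 : M2))).sub h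

theorem IsIntegralOf.adjugate_mul {A B Y Z : ℝ → M2} (hA : ∀ t, (A t).trace = 0)
    (hY : IsIntegralOf Y fun t => A t * Y t) (hZ : IsIntegralOf Z fun t => B t * Z t) :
    IsIntegralOf (fun x => (Y x).adjugate * Z x) fun t => (Y t).adjugate * (B t - A t) * Z t := by
  have hA' : ∀ t, (A t).adjugate = -A t := fun t => by
    rw [adjugate_eq_trace_smul_one_sub, hA, zero_smul, zero_sub]
  convert hY.adjugate.mul hZ using 2 with t
  rw [adjugate_mul_distrib, hA']
  noncomm_ring

theorem IsIntegralOf.det_eq_one {A Y : ℝ → M2} (hA : ∀ t, (A t).trace = 0)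
    (hY : IsIntegralOf Y fun t => A t * Y t) (h0 : Y 0 = 1) (x : ℝ) : (Y x).det = 1 := by
  have h := (hY.adjugate_mul hA hY).eq_add x
  simp only [sub_self, mul_zero, zero_mul, intervalIntegral.integral_zero, h0, adjugate_one,
    mul_one, add_zero, Matrix.adjugate_mul] at h
  simpa using congrFun (congrFun h 0) 0

theorem eq_zero_of_definite_pairing_eq_zero {s u a b g h c d : ℝ} (hS : a ^ 2 + b ^ 2 ≤ s * u)
    (hg : 0 < g) (hh : 0 < h) (hG : c ^ 2 + d ^ 2 < g * h)
    (h0 : s * g + u * h + 2 * (a * c + b * d) = 0) : s = 0 ∧ u = 0 ∧ a = 0 ∧ b = 0 := by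
  have cauchy : (a * c + b * d) ^ 2 ≤ s * u * (c ^ 2 + d ^ 2) := by
    nlinarith [sq_nonneg (a * d - b * c), mul_le_mul_of_nonneg_right hS
      (add_nonneg (sq_nonneg c) (sq_nonneg d))]
  have amgm : 4 * (s * u) * (g * h) ≤ 4 * (a * c + b * d) ^ 2 := by
    have : s * g + u * h = -(2 * (a * c + b * d)) := by linarith
    have := congrArg (· ^ 2) this
    nlinarith [sq_nonneg (s * g - u * h)]
  have hsu : s * u = 0 := le_antisymm
    (nonpos_of_mul_nonpos_left (by linarith : s * u * (g * h - (c ^ 2 + d ^ 2)) ≤ 0)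
      (by linarith)) (by nlinarith [sq_nonneg a, sq_nonneg b])
  have ha : a = 0 := by nlinarith [sq_nonneg a, sq_nonneg b]
  have hb : b = 0 := by nlinarith [sq_nonneg a, sq_nonneg b]
  rw [ha, hb] at h0
  rcases mul_eq_zero.1 hsu with rfl | rfl
  · exact ⟨rfl, by nlinarith, ha, hb⟩
  · exact ⟨by nlinarith, rfl, ha, hb⟩

open scoped ComplexOrder in
theorem eq_zero_of_trace_mul_posDef_eq_zero {S G : M2} (hS : S.IsHermitian) (hdet : 0 ≤ S.det)
    (hG : G.PosDef) (h : (S * G).trace = 0) : S = 0 := by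
  have hdetG := (Complex.pos_iff.1 hG.det_pos).1
  have hdetS := (Complex.nonneg_iff.1 hdet).1
  have htr := congrArg Complex.re h
  have im_eq_zero {A : M2} (hA : A.IsHermitian) (i : Fin 2) : (A i i).im = 0 :=
    Complex.conj_eq_iff_im.1 (hA.apply i i)
  rw [det_fin_two, ← hS.apply 1 0] at hdetS
  rw [det_fin_two, ← hG.1.apply 1 0] at hdetG
  rw [trace_fin_two, Matrix.mul_apply, Matrix.mul_apply, Fin.sum_univ_two, Fin.sum_univ_two,
    ← hS.apply 1 0, ← hG.1.apply 1 0] at htr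
  simp only [Complex.star_def, Complex.sub_re, Complex.add_re, Complex.mul_re, Complex.conj_re,
    Complex.conj_im, Complex.zero_re, im_eq_zero hS, im_eq_zero hG.1] at hdetS hdetG htr
  obtain ⟨h00, h11, hre, him⟩ := eq_zero_of_definite_pairing_eq_zero
    (s := (S 0 0).re) (u := (S 1 1).re) (a := (S 0 1).re) (b := (S 0 1).im)
    (g := (G 0 0).re) (h := (G 1 1).re) (c := (G 0 1).re) (d := (G 0 1).im)
    (by linarith) (Complex.pos_iff.1 hG.diag_pos).1 (Complex.pos_iff.1 hG.diag_pos).1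
    (by linarith) (by linarith)
  have h01 : S 0 1 = 0 := Complex.ext hre him
  ext i j
  fin_cases i <;> fin_cases j
  · exact Complex.ext h00 (im_eq_zero hS 0)
  · exact h01
  · simpa [h01] using (hS.apply 1 0).symm
  · exact Complex.ext h11 (im_eq_zero hS 1)

end Adjugate

section PositiveIntegral

theorem map_intervalIntegral {E E' : Type*} [NormedAddCommGroup E] [NormedSpace ℝ E]
    [FiniteDimensional ℝ E] [NormedAddCommGroup E'] [NormedSpace ℝ E'] [CompleteSpace E']
    (L : E →ₗ[ℝ] E') {f : ℝ → E} {a b : ℝ} (hf : IntervalIntegrable f volume a b) :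
    L (∫ t in a..b, f t) = ∫ t in a..b, L (f t) :=
  have := FiniteDimensional.complete ℝ E
  ((LinearMap.toContinuousLinearMap L).intervalIntegral_comp_comm hf).symm

open scoped ComplexOrder in
theorem intervalIntegral_pos_of_forall_pos {f : ℝ → ℂ} (hf : Continuous f) (hpos : ∀ t, 0 < f t)
    {a b : ℝ} (hab : a < b) : 0 < ∫ t in a..b, f t := by
  have hre : f = fun t => ((f t).re : ℂ) := funext fun t =>
    Complex.ext rfl (Complex.pos_iff.1 (hpos t)).2.symm
  rw [hre, intervalIntegral.integral_ofReal, Complex.zero_lt_real]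
  exact intervalIntegral_pos_of_pos ((Complex.continuous_re.comp hf).intervalIntegrable a b)
    (fun t => (Complex.pos_iff.1 (hpos t)).1) hab

open scoped ComplexOrder in
theorem posDef_intervalIntegral {f : ℝ → M2} (hf : Continuous f) (hpos : ∀ t, (f t).PosDef)
    {a b : ℝ} (hab : a < b) : (∫ t in a..b, f t).PosDef := by
  refine .of_dotProduct_mulVec_pos ?_ fun v hv => ?_
  · refine (map_intervalIntegral (Matrix.conjTransposeLinearEquiv (Fin 2) (Fin 2) ℝ ℂ).toLinearMap
      (hf.intervalIntegrable a b)).trans (intervalIntegral.integral_congr fun t _ => ?_)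
    exact (hpos t).1
  · let form : M2 →ₗ[ℝ] ℂ :=
      { toFun := fun A => star v ⬝ᵥ (A *ᵥ v)
        map_add' := fun A B => by rw [add_mulVec, dotProduct_add]
        map_smul' := fun c A => by rw [smul_mulVec, dotProduct_smul, RingHom.id_apply] }
    have hform : star v ⬝ᵥ ((∫ t in a..b, f t) *ᵥ v) = ∫ t in a..b, form (f t) :=
      map_intervalIntegral form (hf.intervalIntegrable a b)
    rw [hform]
    exact intervalIntegral_pos_of_forall_pos
      ((LinearMap.continuous_of_finiteDimensional form).comp hf)
      (fun t => (hpos t).dotProduct_mulVec_pos hv) hab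

end PositiveIntegral

/-- The potential `(p, r; r, -p)` of a Dirac system in canonical form `J Y' + V Y = lam Y`: real,
symmetric, trace free and locally integrable. -/
structure DiracPotential where
  p : ℝ → ℝ
  r : ℝ → ℝ
  p_int : ∀ a b : ℝ, IntervalIntegrable p volume a b
  r_int : ∀ a b : ℝ, IntervalIntegrable r volume a b

namespace DiracPotential

section FundamentalSolution

/-- The matrix of the potential. -/
def mat (V : DiracPotential) (t : ℝ) : M2 := !![(V.p t : ℂ), V.r t; V.r t, -V.p t]

/-- The coefficient of the Dirac system in the form `Y' = J (V - lam) Y`. -/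
def coef (V : DiracPotential) (lam : ℂ) (t : ℝ) : M2 := J * (V.mat t - lam • 1)

variable (V : DiracPotential)

theorem mat_mul_J (t : ℝ) : V.mat t * J = -(J * V.mat t) := by
  ext i j
  fin_cases i <;> fin_cases j <;> simp [J, mat]

theorem coef_sub_coef (lam mu : ℂ) (t : ℝ) :
    V.coef lam t - V.coef mu t = (mu - lam) • J := by
  rw [coef, coef, ← mul_sub, sub_sub_sub_cancel_left, ← sub_smul, mul_smul_comm, mul_one]

theorem coef_eq (lam : ℂ) (t : ℝ) :
    V.coef lam t = !![(V.r t : ℂ), -V.p t - lam; -V.p t + lam, -V.r t] := by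
  rw [coef, mul_sub, mul_smul_comm, mul_one]
  ext i j
  fin_cases i <;> fin_cases j <;> simp [J, mat]

theorem trace_coef (lam : ℂ) (t : ℝ) : (V.coef lam t).trace = 0 := by
  simp [coef_eq, trace_fin_two]

theorem conjTranspose_transpose_coef (lam : ℂ) (t : ℝ) :
    (V.coef lam t)ᴴᵀ = V.coef (starRingEnd ℂ lam) t := by
  ext i j
  fin_cases i <;> fin_cases j <;> simp [coef_eq]

theorem intervalIntegrable_mat (a b : ℝ) : IntervalIntegrable V.mat volume a b := by
  have ofReal {f : ℝ → ℝ} (hf : ∀ a b : ℝ, IntervalIntegrable f volume a b) (a b : ℝ) :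
      IntervalIntegrable (fun t => (f t : ℂ)) volume a b :=
    ⟨(hf a b).1.ofReal, (hf a b).2.ofReal⟩
  refine intervalIntegrable_of_entry (fun i j a b => ?_) a b
  fin_cases i <;> fin_cases j
  · exact ofReal V.p_int a b
  · exact ofReal V.r_int a b
  · exact ofReal V.r_int a b
  · exact (ofReal V.p_int a b).neg

theorem intervalIntegrable_coef (lam : ℂ) (a b : ℝ) :
    IntervalIntegrable (V.coef lam) volume a b :=
  ((((IsIntegralOf.integral V.intervalIntegrable_mat).sub
    (.of_hasDerivAt (fun x => (hasDerivAt_id x).smul_const (lam • (1 : M2)))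
      continuous_const)).const_mul J).congr_ae
    (.of_forall fun t => by rw [one_smul, coef])).intervalIntegrable a b

/-- The fundamental solution of `Y' = J (V - lam) Y` with `Y 0 = 1`. -/
def fund (lam : ℂ) : ℝ → M2 := (exists_isIntegralOf_mul (V.intervalIntegrable_coef lam)).choose

theorem fund_zero (lam : ℂ) : V.fund lam 0 = 1 :=
  (exists_isIntegralOf_mul (V.intervalIntegrable_coef lam)).choose_spec.1

theorem isIntegralOf_fund (lam : ℂ) :
    IsIntegralOf (V.fund lam) fun t => V.coef lam t * V.fund lam t :=
  (exists_isIntegralOf_mul (V.intervalIntegrable_coef lam)).choose_spec.2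

theorem continuous_fund (lam : ℂ) : Continuous (V.fund lam) := (V.isIntegralOf_fund lam).continuous

theorem eq_fund_mul {lam : ℂ} {Y : ℝ → M2} (hY : IsIntegralOf Y fun t => V.coef lam t * Y t) :
    Y = fun x => V.fund lam x * Y 0 := by
  refine hY.eq_of_mul (V.intervalIntegrable_coef lam) ?_ (by rw [fund_zero, one_mul])
  simpa only [mul_assoc] using (V.isIntegralOf_fund lam).mul_const (Y 0)

theorem det_fund (lam : ℂ) (x : ℝ) : (V.fund lam x).det = 1 :=
  (V.isIntegralOf_fund lam).det_eq_one (V.trace_coef lam) (V.fund_zero lam) x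

theorem adjugate_fund_mul_fund (lam : ℂ) (x : ℝ) : (V.fund lam x).adjugate * V.fund lam x = 1 := by
  rw [Matrix.adjugate_mul, det_fund, one_smul]

theorem fund_mul_adjugate_fund (lam : ℂ) (x : ℝ) : V.fund lam x * (V.fund lam x).adjugate = 1 := by
  rw [Matrix.mul_adjugate, det_fund, one_smul]

theorem continuous_transpose_fund_mul_fund (lam mu : ℂ) :
    Continuous fun t => (V.fund mu t)ᵀ * V.fund lam t :=
  (V.continuous_fund mu).matrix_transpose.mul (V.continuous_fund lam)

theorem lagrange_identity (lam mu : ℂ) (x : ℝ) : (V.fund mu x).adjugate * V.fund lam x =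
    1 - (lam - mu) • (J * ∫ t in (0 : ℝ)..x, (V.fund mu t)ᵀ * V.fund lam t) := by
  have hc := V.continuous_transpose_fund_mul_fund lam mu
  have h := (V.isIntegralOf_fund mu).adjugate_mul (V.trace_coef mu) (V.isIntegralOf_fund lam)
  have hderiv : ∀ t, (V.fund mu t).adjugate * (V.coef lam t - V.coef mu t) * V.fund lam t =
      (mu - lam) • (J * ((V.fund mu t)ᵀ * V.fund lam t)) := fun t => by
    rw [coef_sub_coef, mul_smul_comm, adjugate_mul_J, smul_mul_assoc, mul_assoc]
  have h0 := h.eq_add x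
  simp only [hderiv, fund_zero, adjugate_one, mul_one] at h0
  have hJ : J * _ = _ := map_intervalIntegral (LinearMap.mulLeft ℝ J) (hc.intervalIntegrable 0 x)
  rw [h0, intervalIntegral.integral_smul, hJ, ← neg_sub lam, neg_smul, ← sub_eq_add_neg]
  rfl

theorem fund_conj_transpose (lam : ℂ) (x : ℝ) :
    (V.fund (starRingEnd ℂ lam) x)ᵀ = (V.fund lam x)ᴴ := by
  have h := ((V.isIntegralOf_fund lam).linearMap_comp
    (Matrix.conjTransposeLinearEquiv (Fin 2) (Fin 2) ℝ ℂ).toLinearMap).linearMap_comp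
    (Matrix.transposeLinearEquiv (Fin 2) (Fin 2) ℝ ℂ).toLinearMap
  have hconj : IsIntegralOf (fun x => (V.fund lam x)ᴴᵀ)
      fun t => V.coef (starRingEnd ℂ lam) t * (V.fund lam t)ᴴᵀ := by
    refine h.congr_ae (.of_forall fun t => ?_)
    rw [← conjTranspose_transpose_coef, ← transpose_mul, ← conjTranspose_mul]
    rfl
  have := congrFun (V.eq_fund_mul hconj) x
  rw [fund_zero, conjTranspose_one, transpose_one, mul_one] at this
  rw [← this, transpose_transpose]

theorem fund_transpose_of_im_eq_zero {lam : ℂ} (hl : lam.im = 0) (x : ℝ) :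
    (V.fund lam x)ᵀ = (V.fund lam x)ᴴ := by
  rw [← fund_conj_transpose, Complex.conj_eq_iff_im.2 hl]

/-- The Gram matrix of the columns of the fundamental solution on `[0, x]`. -/
def gram (lam : ℂ) (x : ℝ) : M2 := ∫ t in (0 : ℝ)..x, (V.fund lam t)ᴴ * V.fund lam t

open scoped ComplexOrder in
theorem posDef_gram (lam : ℂ) {x : ℝ} (hx : 0 < x) : (V.gram lam x).PosDef := by
  refine posDef_intervalIntegral
    ((V.continuous_fund lam).matrix_conjTranspose.mul (V.continuous_fund lam)) (fun t => ?_) hx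
  refine Matrix.PosDef.conjTranspose_mul_self _ (Matrix.mulVec_injective_of_isUnit ?_)
  rw [Matrix.isUnit_iff_isUnit_det, det_fund]
  exact isUnit_one

open scoped ComplexOrder in
/-- Periodic eigenvalues are real because the system is formally self-adjoint. -/
theorem im_eq_zero_of_trace_eq_two {lam : ℂ} {x : ℝ} (hx : 0 < x)
    (h : (V.fund lam x).trace = 2) : lam.im = 0 := by
  have hdet : (V.fund lam x - 1).det = 0 := by
    rw [det_sub_one, det_fund, h]
    norm_num
  obtain ⟨v, hv, hv0⟩ := exists_mulVec_eq_zero_iff.2 hdet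
  rw [sub_mulVec, one_mulVec, sub_eq_zero] at hv0
  have hL : (V.fund lam x)ᴴ * J * V.fund lam x = J + (lam - starRingEnd ℂ lam) • V.gram lam x := by
    have h := congrArg (J * ·) (V.lagrange_identity lam (starRingEnd ℂ lam) x)
    simp only [mul_sub, mul_smul_comm, ← mul_assoc, J_mul_J, J_mul_adjugate, fund_conj_transpose,
      neg_one_mul, smul_neg, sub_neg_eq_add, mul_one] at h
    exact h
  have hform := congrArg (fun A => star v ⬝ᵥ (A *ᵥ v)) hL
  simp only [add_mulVec, dotProduct_add, smul_mulVec, dotProduct_smul, ← mulVec_mulVec, hv0]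
    at hform
  rw [dotProduct_mulVec, ← star_mulVec, hv0, left_eq_add, smul_eq_mul] at hform
  have hlam := (mul_eq_zero.1 hform).resolve_right
    ((V.posDef_gram lam hx).dotProduct_mulVec_pos hv).ne'
  exact Complex.conj_eq_iff_im.1 (sub_eq_zero.1 hlam).symm

theorem trace_J_mul_gram_eq_zero {lam : ℂ} (hl : lam.im = 0) (x : ℝ) :
    (J * V.gram lam x).trace = 0 := by
  have h := map_intervalIntegral
    ((Matrix.traceLinearMap (Fin 2) ℝ ℂ).comp (LinearMap.mulLeft ℝ J))
    ((V.continuous_transpose_fund_mul_fund lam lam).intervalIntegrable 0 x)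
  simp only [LinearMap.comp_apply, LinearMap.mulLeft_apply, traceLinearMap_apply,
    trace_J_mul_transpose_mul_self, intervalIntegral.integral_zero] at h
  simp only [V.fund_transpose_of_im_eq_zero hl] at h
  exact h

end FundamentalSolution

section SpectralParameter

variable (V : DiracPotential)

theorem exists_norm_fund_le (R x : ℝ) :
    ∃ C, ∀ lam : ℂ, ‖lam‖ ≤ R → ∀ t ∈ uIcc 0 x, ‖V.fund lam t‖ ≤ C := by
  refine ⟨Real.exp |∫ s in (0 : ℝ)..x, (‖V.coef 0 s‖ + R)|, fun lam hlam t ht => ?_⟩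
  have hcoef : ∀ s, ‖V.coef lam s‖ ≤ ‖V.coef 0 s‖ + R := fun s => by
    rw [← sub_add_cancel (V.coef lam s) (V.coef 0 s), coef_sub_coef, zero_sub, add_comm]
    refine (norm_add_le _ _).trans (add_le_add_right ?_ _)
    rw [norm_smul, norm_neg, ← mul_one R]
    exact mul_le_mul hlam norm_J_le_one (norm_nonneg _) ((norm_nonneg _).trans hlam)
  refine ((V.isIntegralOf_fund lam).norm_le_of_mul (V.intervalIntegrable_coef lam) t).trans ?_
  rw [fund_zero, norm_one, one_mul]
  refine Real.exp_le_exp.2 ?_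
  calc |∫ s in (0 : ℝ)..t, ‖V.coef lam s‖|
      ≤ |∫ s in (0 : ℝ)..x, ‖V.coef lam s‖| :=
        abs_integral_mono_interval
          (uIoc_subset_uIoc_of_uIcc_subset_uIcc (uIcc_subset_uIcc left_mem_uIcc ht))
          (.of_forall fun _ => norm_nonneg _) (V.intervalIntegrable_coef lam 0 x).norm
    _ ≤ |∫ s in (0 : ℝ)..x, (‖V.coef 0 s‖ + R)| :=
        norm_integral_le_abs_of_norm_le (f := fun s => ‖V.coef lam s‖)
          (.of_forall fun s => by rw [norm_norm]; exact hcoef s)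
          ((V.intervalIntegrable_coef 0 0 x).norm.add intervalIntegrable_const)

theorem exists_norm_transpose_fund_mul_fund_le (mu : ℂ) (x : ℝ) :
    ∃ C, ∀ᶠ lam in 𝓝 mu, ∀ t ∈ uIcc 0 x, ‖(V.fund mu t)ᵀ * V.fund lam t‖ ≤ C := by
  obtain ⟨C, hC⟩ := V.exists_norm_fund_le (‖mu‖ + 1) x
  obtain ⟨D, hD⟩ := (isCompact_uIcc (a := (0 : ℝ)) (b := x)).exists_bound_of_continuousOn
    (V.continuous_fund mu).matrix_transpose.continuousOn
  refine ⟨D * C, ?_⟩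
  filter_upwards [(continuous_norm.tendsto mu).eventually_le_const (lt_add_one _)]
    with lam hlam t ht
  exact (norm_mul_le _ _).trans (mul_le_mul (hD t ht) (hC lam hlam t ht) (norm_nonneg _)
    ((norm_nonneg _).trans (hD t ht)))

theorem fund_sub_fund (lam mu : ℂ) (x : ℝ) : V.fund lam x - V.fund mu x =
    (lam - mu) • -(V.fund mu x * J * ∫ t in (0 : ℝ)..x, (V.fund mu t)ᵀ * V.fund lam t) := by
  have h := congrArg (V.fund mu x * ·) (V.lagrange_identity lam mu x)
  simp only [← mul_assoc, fund_mul_adjugate_fund, one_mul, mul_sub, mul_one, mul_smul_comm] at h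
  rw [h, sub_sub_cancel_left, smul_neg]

theorem continuousAt_fund (mu : ℂ) (x : ℝ) : ContinuousAt (fun lam => V.fund lam x) mu := by
  obtain ⟨C, hC⟩ := V.exists_norm_transpose_fund_mul_fund_le mu x
  have hz : Tendsto (fun lam => ‖lam - mu‖ * (‖V.fund mu x * J‖ * (C * |x - 0|))) (𝓝 mu)
      (𝓝 0) := by
    have : Continuous fun lam => ‖lam - mu‖ * (‖V.fund mu x * J‖ * (C * |x - 0|)) := by fun_prop
    simpa using this.tendsto mu
  refine tendsto_iff_norm_sub_tendsto_zero.2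
    (squeeze_zero' (.of_forall fun _ => norm_nonneg _) ?_ hz)
  filter_upwards [hC] with lam hlam
  rw [V.fund_sub_fund, norm_smul, norm_neg]
  gcongr
  refine (norm_mul_le _ _).trans ?_
  gcongr
  exact norm_integral_le_of_norm_le_const fun t ht => hlam t (uIoc_subset_uIcc ht)

theorem hasDerivAt_fund (mu : ℂ) (x : ℝ) :
    HasDerivAt (fun lam => V.fund lam x)
      (-(V.fund mu x * J * ∫ t in (0 : ℝ)..x, (V.fund mu t)ᵀ * V.fund mu t)) mu := by
  obtain ⟨C, hC⟩ := V.exists_norm_transpose_fund_mul_fund_le mu x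
  have hI : ContinuousAt (fun lam => ∫ t in (0 : ℝ)..x, (V.fund mu t)ᵀ * V.fund lam t) mu := by
    refine continuousAt_of_dominated_interval (bound := fun _ => C)
      (.of_forall fun lam => (V.continuous_transpose_fund_mul_fund lam mu).aestronglyMeasurable) ?_
      intervalIntegrable_const
      (.of_forall fun t _ => continuousAt_const.mul (V.continuousAt_fund mu t))
    filter_upwards [hC] with lam hlam
    exact .of_forall fun t ht => hlam t (uIoc_subset_uIcc ht)
  refine hasDerivAt_iff_tendsto_slope.2
    (((hI.tendsto.const_mul (V.fund mu x * J)).neg.mono_left nhdsWithin_le_nhds).congr' ?_)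
  filter_upwards [self_mem_nhdsWithin] with lam hlam
  rw [slope_def_module, V.fund_sub_fund lam mu x, inv_smul_smul₀ (sub_ne_zero.2 hlam)]

theorem hasDerivAt_map_fund (L : M2 →ₗ[ℂ] ℂ) (lam : ℂ) (x : ℝ) :
    HasDerivAt (fun lam => L (V.fund lam x))
      (L (-(V.fund lam x * J * ∫ t in (0 : ℝ)..x, (V.fund lam t)ᵀ * V.fund lam t))) lam :=
  (LinearMap.toContinuousLinearMap L).hasFDerivAt.comp_hasDerivAt lam (V.hasDerivAt_fund lam x)

theorem differentiable_map_fund (L : M2 →ₗ[ℂ] ℂ) (x : ℝ) :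
    Differentiable ℂ fun lam => L (V.fund lam x) :=
  fun lam => (V.hasDerivAt_map_fund L lam x).differentiableAt

theorem hasDerivAt_map_fund_of_im_eq_zero (L : M2 →ₗ[ℂ] ℂ) {lam : ℂ} (hl : lam.im = 0) (x : ℝ) :
    HasDerivAt (fun lam => L (V.fund lam x)) (L (-(V.fund lam x * J * V.gram lam x))) lam := by
  have h := V.hasDerivAt_map_fund L lam x
  simp only [V.fund_transpose_of_im_eq_zero hl] at h
  exact h

end SpectralParameter

end DiracPotential

theorem trace_adjugate_transpose_mul_self (A : M2) :
    (Aᵀ.adjugate * A).trace = 2 * A.det - (J * A).trace ^ 2 := by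
  simp only [J, trace_fin_two, det_fin_two, adjugate_fin_two, Matrix.mul_apply, transpose_apply,
    Fin.sum_univ_two, of_apply, cons_val', cons_val_zero, cons_val_one, cons_val_fin_one]
  ring

theorem transpose_eq_self_of_trace_J_mul_eq_zero {A : M2} (h : (J * A).trace = 0) : Aᵀ = A := by
  have h01 : A 0 1 = A 1 0 := by
    simp only [J, trace_fin_two, Matrix.mul_apply, Fin.sum_univ_two, of_apply, cons_val',
      cons_val_zero, cons_val_one, cons_val_fin_one] at h
    linear_combination -h
  ext i j
  fin_cases i <;> fin_cases j <;> simp [h01]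

namespace DiracPotential

/-- The discriminant of the Dirac system over `[0, l]`: the trace of the transfer matrix. -/
def disc (V : DiracPotential) (l : ℝ) (lam : ℂ) : ℂ := (V.fund lam l).trace

variable (V : DiracPotential)

theorem differentiable_disc (l : ℝ) : Differentiable ℂ (V.disc l) :=
  V.differentiable_map_fund (Matrix.traceLinearMap (Fin 2) ℂ ℂ) l

open scoped ComplexOrder in
/-- With `Φ = V.fund lam l`, `(Φ - 1) J` is Hermitian with determinant `2 - tr Φ = 0`, and the
derivative of the discriminant pairs it with the positive definite Gram matrix. -/
theorem fund_eq_one_of_deriv_disc_eq_zero {l : ℝ} (hl : 0 < l) {lam : ℂ} (h : V.disc l lam = 2)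
    (h' : deriv (V.disc l) lam = 0) : V.fund lam l = 1 := by
  have hlam : lam.im = 0 := V.im_eq_zero_of_trace_eq_two hl h
  have hherm : ((V.fund lam l - 1) * J).IsHermitian := by
    rw [Matrix.IsHermitian, conjTranspose_mul, conjTranspose_sub, conjTranspose_one,
      ← V.fund_transpose_of_im_eq_zero hlam, conjTranspose_J, mul_sub, neg_mul, ← adjugate_mul_J,
      adjugate_eq_trace_smul_one_sub, show (V.fund lam l).trace = 2 from h]
    rw [sub_mul, Matrix.smul_mul, one_mul, sub_mul, one_mul, mul_one, two_smul]
    abel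
  have hdet : ((V.fund lam l - 1) * J).det = 0 := by
    rw [det_mul, det_sub_one, det_fund, show (V.fund lam l).trace = 2 from h]
    norm_num
  have htrace : ((V.fund lam l - 1) * J * V.gram lam l).trace = 0 := by
    have hd := V.hasDerivAt_map_fund_of_im_eq_zero (Matrix.traceLinearMap (Fin 2) ℂ ℂ) hlam l
    have hd' := hd.deriv.symm.trans h'
    rw [traceLinearMap_apply, trace_neg, neg_eq_zero] at hd'
    rw [sub_mul, one_mul, sub_mul, trace_sub, hd', V.trace_J_mul_gram_eq_zero hlam, sub_zero]
  have hzero := congrArg (· * J)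
    (eq_zero_of_trace_mul_posDef_eq_zero hherm hdet.ge (V.posDef_gram lam hl) htrace)
  simp only [mul_assoc, J_mul_J, mul_neg, mul_one, zero_mul, neg_eq_zero] at hzero
  exact sub_eq_zero.1 hzero

section Antiperiodic

variable {V} {l : ℝ}

theorem J_mul_fund_add (hV : ∀ᵐ x, V.mat (x + l) = -V.mat x) (lam : ℂ) (x : ℝ) :
    J * V.fund lam (x + l) = V.fund lam x * (J * V.fund lam l) := by
  have h : IsIntegralOf (fun x => J * V.fund lam (x + l))
      fun t => V.coef lam t * (J * V.fund lam (t + l)) := by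
    refine (((V.isIntegralOf_fund lam).comp_add_right l).const_mul J).congr_ae ?_
    filter_upwards [hV] with t ht
    have hcomm : J * V.coef lam (t + l) = V.coef lam t * J := by
      rw [coef, coef, ht, mul_assoc, sub_mul, V.mat_mul_J, smul_mul_assoc, one_mul, mul_sub,
        mul_neg, mul_smul_comm, mul_one]
    rw [← mul_assoc, hcomm, mul_assoc]
  simpa only [zero_add] using congrFun (V.eq_fund_mul h) x

theorem disc_add_self_sub_two (hV : ∀ᵐ x, V.mat (x + l) = -V.mat x) (lam : ℂ) :
    V.disc (l + l) lam - 2 = (Complex.I * (J * V.fund lam l).trace) ^ 2 := by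
  have h : V.fund lam (l + l) = (V.fund lam l)ᵀ.adjugate * V.fund lam l := by
    have h := congrArg (-J * ·) (J_mul_fund_add hV lam l)
    simpa only [← mul_assoc, neg_mul, J_mul_J, neg_neg, one_mul, J_mul_mul_J] using h
  rw [disc, h, trace_adjugate_transpose_mul_self, det_fund, mul_pow, Complex.I_sq]
  ring

open scoped ComplexOrder in
theorem deriv_trace_J_mul_fund_ne_zero (V : DiracPotential) (hl : 0 < l) {lam : ℂ}
    (hlam : lam.im = 0) (h : (J * V.fund lam l).trace = 0) :
    deriv (fun lam => (J * V.fund lam l).trace) lam ≠ 0 := by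
  have hd := V.hasDerivAt_map_fund_of_im_eq_zero
    ((Matrix.traceLinearMap (Fin 2) ℂ ℂ).comp (LinearMap.mulLeft ℂ J)) hlam l
  intro h'
  have hsymm := transpose_eq_self_of_trace_J_mul_eq_zero h
  have htrace : ((V.fund lam l).adjugate * V.gram lam l).trace = 0 := by
    have := hd.deriv.symm.trans h'
    rwa [LinearMap.comp_apply, LinearMap.mulLeft_apply, traceLinearMap_apply, mul_neg, ← mul_assoc,
      ← mul_assoc, J_mul_mul_J, neg_mul, neg_neg, hsymm] at this
  have hherm : (V.fund lam l).IsHermitian :=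
    (V.fund_transpose_of_im_eq_zero hlam l).symm.trans hsymm
  have hdet : (V.fund lam l).adjugate.det = 1 := by
    rw [det_adjugate, det_fund, one_pow]
  have hzero := eq_zero_of_trace_mul_posDef_eq_zero hherm.adjugate (hdet ▸ zero_le_one)
    (V.posDef_gram lam hl) htrace
  rw [hzero, det_zero] at hdet
  exact zero_ne_one hdet

theorem onlyDoubleZeros_of_antiperiodic (hl : 0 < l) (hV : ∀ᵐ x, V.mat (x + l) = -V.mat x) :
    OnlyDoubleZeros fun lam => V.disc (l + l) lam - 2 := by
  intro lam h0
  have hlam : lam.im = 0 := V.im_eq_zero_of_trace_eq_two (add_pos hl hl) (sub_eq_zero.1 h0)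
  have hs : (J * V.fund lam l).trace = 0 := by
    simpa [disc_add_self_sub_two hV] using h0
  have hdiff : Differentiable ℂ fun lam => (J * V.fund lam l).trace :=
    V.differentiable_map_fund ((Matrix.traceLinearMap (Fin 2) ℂ ℂ).comp (LinearMap.mulLeft ℂ J)) l
  have han := (hdiff.const_mul Complex.I).analyticAt lam
  have hone := han.analyticOrderAt_eq_one_of_zero_deriv_ne_zero (by rw [hs, mul_zero]) <| by
    rw [deriv_const_mul _ (hdiff lam)]
    exact mul_ne_zero Complex.I_ne_zero (V.deriv_trace_J_mul_fund_ne_zero hl hlam hs)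
  have hsq : (fun lam => V.disc (l + l) lam - 2) =
      (fun lam => Complex.I * (J * V.fund lam l).trace) ^ 2 :=
    funext fun lam => disc_add_self_sub_two hV lam
  rw [hsq, analyticOrderAt_pow han, hone]
  rfl

end Antiperiodic

end DiracPotential

section Rotation

/-- The matrix `exp (z J)`. -/
def rot (z : ℂ) : M2 := Complex.cos z • 1 + Complex.sin z • J

theorem rot_zero : rot 0 = 1 := by
  rw [rot, Complex.cos_zero, Complex.sin_zero, one_smul, zero_smul, add_zero]

theorem rot_add (a b : ℂ) : rot (a + b) = rot a * rot b := by
  simp only [rot, Complex.cos_add, Complex.sin_add, add_mul, mul_add, Matrix.smul_mul,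
    Matrix.mul_smul, smul_smul, J_mul_J, mul_one, one_mul, smul_neg]
  module

theorem rot_neg_mul_rot (a : ℂ) : rot (-a) * rot a = 1 := by
  rw [← rot_add, neg_add_cancel, rot_zero]

theorem J_mul_rot (z : ℂ) : J * rot z = rot z * J := by
  simp only [rot, mul_add, add_mul, Matrix.smul_mul, Matrix.mul_smul, mul_one, one_mul]

theorem trace_rot (z : ℂ) : (rot z).trace = 2 * Complex.cos z := by
  rw [rot, trace_add, trace_smul, trace_smul, trace_J, trace_one, Fintype.card_fin, smul_eq_mul,
    smul_zero, add_zero, Nat.cast_ofNat, mul_comm]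

theorem hasDerivAt_rot (z : ℂ) : HasDerivAt rot (J * rot z) z := by
  refine (((Complex.hasDerivAt_cos z).smul_const (1 : M2)).add
    ((Complex.hasDerivAt_sin z).smul_const J)).congr_deriv ?_
  simp only [rot, mul_add, Matrix.mul_smul, J_mul_J, mul_one]
  module

theorem continuous_rot : Continuous rot :=
  continuous_iff_continuousAt.2 fun z => (hasDerivAt_rot z).continuousAt

theorem isIntegralOf_rot (a b : ℂ) :
    IsIntegralOf (fun t : ℝ => rot (a * t + b)) fun t => a • (J * rot (a * t + b)) := by
  refine .of_hasDerivAt (fun t => ?_)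
    ((continuous_const.mul (continuous_rot.comp (by fun_prop))).const_smul a)
  have haffine : HasDerivAt (fun t : ℝ => a * t + b) a t := by
    simpa using ((Complex.ofRealCLM.hasDerivAt (x := t)).const_mul a).add_const b
  exact (hasDerivAt_rot _).scomp t haffine

theorem norm_cos_le (z : ℂ) : ‖Complex.cos z‖ ≤ Real.exp |z.im| := by
  have norm_exp_le {w : ℂ} (hw : w.re ≤ |z.im|) : ‖Complex.exp w‖ ≤ Real.exp |z.im| :=
    (Complex.norm_exp w).trans_le (Real.exp_le_exp.2 hw)
  have h₁ := norm_exp_le (w := z * Complex.I) (by simpa using neg_le_abs z.im)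
  have h₂ := norm_exp_le (w := -z * Complex.I) (by simpa using le_abs_self z.im)
  rw [Complex.cos, norm_div, Complex.norm_ofNat]
  linarith [norm_add_le (Complex.exp (z * Complex.I)) (Complex.exp (-z * Complex.I))]

theorem norm_sin_le (z : ℂ) : ‖Complex.sin z‖ ≤ Real.exp |z.im| := by
  have h := norm_cos_le (z - Real.pi / 2)
  rw [Complex.cos_sub_pi_div_two] at h
  simpa using h

theorem norm_rot_le (z : ℂ) : ‖rot z‖ ≤ 2 * Real.exp |z.im| := by
  calc ‖rot z‖ ≤ ‖Complex.cos z‖ * ‖(1 : M2)‖ + ‖Complex.sin z‖ * ‖J‖ :=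
        (norm_add_le _ _).trans (add_le_add (norm_smul_le _ _) (norm_smul_le _ _))
    _ ≤ Real.exp |z.im| * 1 + Real.exp |z.im| * 1 := by
        gcongr
        exacts [norm_cos_le z, norm_one.le, norm_sin_le z, norm_J_le_one]
    _ = 2 * Real.exp |z.im| := by ring

end Rotation

section RiemannLebesgue

theorem exists_contDiff_integral_norm_sub_le {E : Type*} [NormedAddCommGroup E] [NormedSpace ℝ E]
    {q : ℝ → E} {l : ℝ} (hl : 0 ≤ l) (hq : IntervalIntegrable q volume 0 l) {ε : ℝ} (hε : 0 < ε) :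
    ∃ g : ℝ → E, HasCompactSupport g ∧ ContDiff ℝ 1 g ∧ ∫ t in (0 : ℝ)..l, ‖q t - g t‖ ≤ ε := by
  have hq' := (intervalIntegrable_iff_integrableOn_Ioc_of_le hl).1 hq
  obtain ⟨g, hgs, hg, hqg⟩ :=
    (memLp_one_iff_integrable.2 hq').exist_eLpNorm_sub_le ENNReal.one_ne_top le_rfl hε
  refine ⟨g, hgs, hg.of_le (by exact_mod_cast le_top), ?_⟩
  have hsub : Integrable (q - g) (volume.restrict (Ioc 0 l)) :=
    hq'.sub (hg.continuous.integrable_of_hasCompactSupport hgs)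
  rw [integral_of_le hl]
  rw [eLpNorm_one_eq_lintegral_enorm] at hqg
  exact (integral_norm_eq_lintegral_enorm hsub.1).trans_le
    (ENNReal.toReal_le_of_le_ofReal hε.le hqg)

theorem norm_le_norm_J_mul (X : M2) : ‖X‖ ≤ ‖J * X‖ := by
  calc ‖X‖ = ‖J * (J * X)‖ := by rw [← mul_assoc, J_mul_J, neg_one_mul, norm_neg]
    _ ≤ 1 * ‖J * X‖ := (norm_mul_le _ _).trans (by gcongr; exact norm_J_le_one)
    _ = ‖J * X‖ := one_mul _

theorem norm_rot_phase_le (lam : ℂ) {x t : ℝ} (ht : t ∈ Icc 0 x) :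
    ‖rot (lam * (2 * t - x))‖ ≤ 2 * Real.exp (|lam.im| * x) := by
  refine (norm_rot_le _).trans ?_
  have him : (lam * (2 * t - x)).im = lam.im * (2 * t - x) := by simp
  rw [him, abs_mul]
  gcongr
  exact abs_le.2 ⟨by linarith [ht.1], by linarith [ht.2]⟩

theorem continuous_rot_phase (lam : ℂ) (x : ℝ) :
    Continuous fun t : ℝ => rot (lam * (2 * t - x)) := continuous_rot.comp (by fun_prop)

theorem smul_J_mul_integral_rot_phase_mul {g g' : ℝ → M2} (hg : IsIntegralOf g g') (lam : ℂ)
    (x : ℝ) : (2 * lam) • (J * ∫ t in (0 : ℝ)..x, rot (lam * (2 * t - x)) * g t) =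
      rot (lam * (2 * x - x)) * g x - rot (lam * (2 * (0 : ℝ) - x)) * g 0 -
        ∫ t in (0 : ℝ)..x, rot (lam * (2 * t - x)) * g' t := by
  set A : ℝ → M2 := fun t => rot (lam * (2 * t - x))
  have hAc : Continuous A := continuous_rot_phase lam x
  have hA : IsIntegralOf A fun t => (2 * lam) • (J * A t) := by
    have h := isIntegralOf_rot (2 * lam) (-(lam * x))
    have hphase : ∀ t : ℝ, 2 * lam * t + -(lam * x) = lam * (2 * t - x) := fun t => by ring
    simpa only [hphase] using h
  have hAg : IntervalIntegrable (fun t => (2 * lam) • (J * A t) * g t) volume 0 x :=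
    (((hAc.const_mul J).const_smul (2 * lam)).mul hg.continuous).intervalIntegrable 0 x
  have hAg' : IntervalIntegrable (fun t => A t * g' t) volume 0 x :=
    (hg.intervalIntegrable 0 x).continuousOn_mul hAc.continuousOn
  have hJAg : ∫ t in (0 : ℝ)..x, (2 * lam) • (J * A t) * g t =
      (2 * lam) • (J * ∫ t in (0 : ℝ)..x, A t * g t) := by
    simp only [Matrix.smul_mul, mul_assoc]
    rw [intervalIntegral.integral_smul]
    exact congrArg ((2 * lam) • ·) (map_intervalIntegral (LinearMap.mulLeft ℝ J)
      ((hAc.mul hg.continuous).intervalIntegrable 0 x)).symm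
  have hparts : A x * g x = A 0 * g 0 + _ := (hA.mul hg).eq_add x
  rw [integral_add hAg hAg', hJAg] at hparts
  change _ = A x * g x - A 0 * g 0 - _
  rw [hparts]
  abel

theorem norm_integral_rot_phase_mul_le {q : ℝ → M2} {x : ℝ}
    (hq : IntervalIntegrable q volume 0 x) (hx : 0 ≤ x) (lam : ℂ) :
    ‖∫ t in (0 : ℝ)..x, rot (lam * (2 * t - x)) * q t‖ ≤
      2 * Real.exp (|lam.im| * x) * ∫ t in (0 : ℝ)..x, ‖q t‖ := by
  rw [← intervalIntegral.integral_const_mul]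
  exact norm_integral_le_of_norm_le hx (.of_forall fun t ht => (norm_mul_le _ _).trans
    (by gcongr; exact norm_rot_phase_le lam ⟨ht.1.le, ht.2⟩)) (hq.norm.const_mul _)

theorem norm_integral_rot_phase_mul_le_div {g g' : ℝ → M2} (hg : IsIntegralOf g g') {M N : ℝ}
    (hM : ∀ t, ‖g t‖ ≤ M) (hN : ∀ t, ‖g' t‖ ≤ N) {lam : ℂ} (hlam : lam ≠ 0) {x : ℝ} (hx : 0 ≤ x) :
    ‖∫ t in (0 : ℝ)..x, rot (lam * (2 * t - x)) * g t‖ ≤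
      (2 * M + N * x) / ‖lam‖ * Real.exp (|lam.im| * x) := by
  set E := Real.exp (|lam.im| * x)
  set X := ∫ t in (0 : ℝ)..x, rot (lam * (2 * t - x)) * g t
  have hboundary {t : ℝ} (ht : t ∈ Icc 0 x) : ‖rot (lam * (2 * t - x)) * g t‖ ≤ 2 * E * M :=
    (norm_mul_le _ _).trans
      (mul_le_mul (norm_rot_phase_le lam ht) (hM t) (norm_nonneg _) (by positivity))
  have hint : ‖∫ t in (0 : ℝ)..x, rot (lam * (2 * t - x)) * g' t‖ ≤ 2 * E * (N * x) := by
    refine (norm_integral_rot_phase_mul_le (hg.intervalIntegrable 0 x) hx lam).trans ?_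
    gcongr
    simpa [abs_of_nonneg hx] using (le_abs_self _).trans
      (norm_integral_le_of_norm_le_const (a := 0) (b := x) (f := fun t => ‖g' t‖)
        fun t _ => (norm_norm _).trans_le (hN t))
  have hsum : 2 * ‖lam‖ * ‖J * X‖ ≤ 2 * E * M + 2 * E * M + 2 * E * (N * x) := by
    calc 2 * ‖lam‖ * ‖J * X‖ = ‖(2 * lam) • (J * X)‖ := by
          rw [norm_smul, Complex.norm_mul, Complex.norm_ofNat]
      _ ≤ _ := by
          rw [smul_J_mul_integral_rot_phase_mul hg]
          exact (norm_sub_le _ _).trans (add_le_add ((norm_sub_le _ _).trans (add_le_add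
            (hboundary ⟨hx, le_rfl⟩) (hboundary ⟨le_rfl, hx⟩))) hint)
  have hXJ : ‖lam‖ * ‖X‖ ≤ ‖lam‖ * ‖J * X‖ := by gcongr; exact norm_le_norm_J_mul X
  rw [div_mul_eq_mul_div, le_div_iff₀ (norm_pos_iff.2 hlam)]
  linarith

theorem exists_norm_integral_rot_phase_mul_le {q : ℝ → M2}
    (hq : ∀ a b : ℝ, IntervalIntegrable q volume a b) {l : ℝ} (hl : 0 ≤ l) {ε : ℝ} (hε : 0 < ε) :
    ∃ R, ∀ lam : ℂ, R ≤ ‖lam‖ → ∀ x ∈ Icc 0 l,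
      ‖∫ t in (0 : ℝ)..x, rot (lam * (2 * t - x)) * q t‖ ≤ ε * Real.exp (|lam.im| * x) := by
  obtain ⟨g, hgs, hg, hqg⟩ :=
    exists_contDiff_integral_norm_sub_le hl (hq 0 l) (show 0 < ε / 4 by positivity)
  have hg' : Continuous (deriv g) := hg.continuous_deriv le_rfl
  obtain ⟨M, hM⟩ := hg.continuous.bounded_above_of_compact_support hgs
  obtain ⟨N, hN⟩ := hg'.bounded_above_of_compact_support hgs.deriv
  have hN0 : 0 ≤ N := (norm_nonneg _).trans (hN 0)
  have hgI : IsIntegralOf g (deriv g) :=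
    .of_hasDerivAt (fun t => (hg.differentiable one_ne_zero t).hasDerivAt) hg'
  refine ⟨max 1 ((2 * M + N * l) / (ε / 2)), fun lam hlam x hx => ?_⟩
  have hlam0 : 0 < ‖lam‖ := zero_lt_one.trans_le ((le_max_left _ _).trans hlam)
  have hA : Continuous fun t : ℝ => rot (lam * (2 * t - x)) := continuous_rot_phase lam x
  have hsub : IntervalIntegrable (fun t => q t - g t) volume 0 x :=
    (hq 0 x).sub (hg.continuous.intervalIntegrable 0 x)
  have hsplit : ∫ t in (0 : ℝ)..x, rot (lam * (2 * t - x)) * q t =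
      (∫ t in (0 : ℝ)..x, rot (lam * (2 * t - x)) * (q t - g t)) +
        ∫ t in (0 : ℝ)..x, rot (lam * (2 * t - x)) * g t := by
    have hAg : IntervalIntegrable (fun t : ℝ => rot (lam * (2 * t - x)) * g t) volume 0 x :=
      (hA.mul hg.continuous).intervalIntegrable 0 x
    rw [← integral_add (hsub.continuousOn_mul hA.continuousOn) hAg]
    simp only [← mul_add, sub_add_cancel]
  have hrough : ‖∫ t in (0 : ℝ)..x, rot (lam * (2 * t - x)) * (q t - g t)‖ ≤
      ε / 2 * Real.exp (|lam.im| * x) := by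
    calc _ ≤ 2 * Real.exp (|lam.im| * x) * ∫ t in (0 : ℝ)..x, ‖q t - g t‖ :=
          norm_integral_rot_phase_mul_le hsub hx.1 lam
      _ ≤ 2 * Real.exp (|lam.im| * x) * (ε / 4) := by
          gcongr
          exact (integral_mono_interval le_rfl hx.1 hx.2 (.of_forall fun t => norm_nonneg _)
            ((hq 0 l).sub (hg.continuous.intervalIntegrable 0 l)).norm).trans hqg
      _ = ε / 2 * Real.exp (|lam.im| * x) := by ring
  have hsmooth : ‖∫ t in (0 : ℝ)..x, rot (lam * (2 * t - x)) * g t‖ ≤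
      ε / 2 * Real.exp (|lam.im| * x) := by
    refine (norm_integral_rot_phase_mul_le_div hgI hM hN (norm_pos_iff.1 hlam0) hx.1).trans ?_
    refine mul_le_mul_of_nonneg_right ?_ (Real.exp_pos _).le
    rw [div_le_comm₀ hlam0 (half_pos hε)]
    refine le_trans ?_ ((le_max_right _ _).trans hlam)
    gcongr
    exact hx.2
  rw [hsplit]
  linarith [(norm_add_le _ _).trans (add_le_add hrough hsmooth)]

end RiemannLebesgue

namespace DiracPotential

section Asymptotics

variable (V : DiracPotential)

theorem coef_zero_mul_J (t : ℝ) : V.coef 0 t * J = -(J * V.coef 0 t) := by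
  rw [coef, zero_smul, sub_zero, mul_assoc, mat_mul_J, mul_neg]

theorem coef_zero_mul_rot (t : ℝ) (z : ℂ) : V.coef 0 t * rot (-z) = rot z * V.coef 0 t := by
  simp only [rot, Complex.cos_neg, Complex.sin_neg, neg_smul, mul_add, add_mul, Matrix.mul_smul,
    Matrix.smul_mul, mul_neg, coef_zero_mul_J, mul_one, one_mul, smul_neg, neg_neg]

theorem isIntegralOf_rot_mul_fund (lam b : ℂ) :
    IsIntegralOf (fun t : ℝ => rot (lam * t + b) * V.fund lam t)
      fun t => rot (lam * t + b) * V.coef 0 t * V.fund lam t := by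
  refine ((isIntegralOf_rot lam b).mul (V.isIntegralOf_fund lam)).congr_ae (.of_forall fun t => ?_)
  have hcoef : V.coef lam t = V.coef 0 t - lam • J := by
    rw [sub_eq_iff_eq_add.1 (V.coef_sub_coef 0 lam t), sub_zero, add_sub_cancel_left]
  rw [hcoef, J_mul_rot, sub_mul, mul_sub, Matrix.smul_mul, Matrix.smul_mul, Matrix.mul_smul,
    mul_assoc, mul_assoc, add_sub_cancel]

/-- Duhamel's formula for the potential as a perturbation of the free system; the potential
anticommutes with `J`, which turns the first order term into an oscillating integral. -/
theorem fund_sub_rot (lam : ℂ) (x : ℝ) : V.fund lam x - rot (-(lam * x)) =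
    (∫ t in (0 : ℝ)..x, rot (lam * (2 * t - x)) * V.coef 0 t) +
      ∫ t in (0 : ℝ)..x, rot (lam * t + -(lam * x)) * V.coef 0 t *
        (V.fund lam t - rot (-(lam * t))) := by
  have h := V.isIntegralOf_rot_mul_fund lam (-(lam * x))
  have hx := h.eq_add x
  rw [add_neg_cancel, rot_zero, one_mul, Complex.ofReal_zero, mul_zero, zero_add, fund_zero,
    mul_one] at hx
  have hfree : ∀ t : ℝ, rot (lam * (2 * t - x)) * V.coef 0 t =
      rot (lam * t + -(lam * x)) * V.coef 0 t * rot (-(lam * t)) := fun t => by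
    rw [mul_assoc, coef_zero_mul_rot, ← mul_assoc, ← rot_add]
    ring_nf
  have hosc : IntervalIntegrable (fun t : ℝ => rot (lam * (2 * t - x)) * V.coef 0 t) volume 0 x :=
    (V.intervalIntegrable_coef 0 0 x).continuousOn_mul (continuous_rot_phase lam x).continuousOn
  have hsub := integral_sub (h.intervalIntegrable 0 x) hosc
  simp only [mul_sub (rot _ * _), ← hfree]
  rw [hsub, hx]
  abel

theorem norm_integral_rot_mul_coef_mul_le (lam : ℂ) {D : ℝ → M2} (hD : Continuous D) {x : ℝ}
    (hx : 0 ≤ x) : ‖∫ t in (0 : ℝ)..x, rot (lam * t + -(lam * x)) * V.coef 0 t * D t‖ ≤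
      Real.exp (|lam.im| * x) *
        ∫ t in (0 : ℝ)..x, 2 * ‖V.coef 0 t‖ * (Real.exp (-(|lam.im| * t)) * ‖D t‖) := by
  have hweight : Continuous fun t => Real.exp (-(|lam.im| * t)) * ‖D t‖ := by fun_prop
  rw [← intervalIntegral.integral_const_mul]
  refine norm_integral_le_of_norm_le hx (.of_forall fun t ht => ?_)
    ((((V.intervalIntegrable_coef 0 0 x).norm.const_mul 2).mul_continuousOn
      hweight.continuousOn).const_mul _)
  have hrot : ‖rot (lam * t + -(lam * x))‖ ≤
      2 * (Real.exp (|lam.im| * x) * Real.exp (-(|lam.im| * t))) := by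
    refine (norm_rot_le _).trans_eq ?_
    have him : (lam * t + -(lam * x)).im = -(lam.im * (x - t)) := by
      simp only [Complex.add_im, Complex.neg_im, Complex.im_mul_ofReal]
      ring
    rw [← Real.exp_add, him, abs_neg, abs_mul, abs_of_nonneg (sub_nonneg.2 ht.2)]
    ring_nf
  calc _ ≤ ‖rot (lam * t + -(lam * x))‖ * ‖V.coef 0 t‖ * ‖D t‖ :=
        (norm_mul_le _ _).trans (by gcongr; exact norm_mul_le _ _)
    _ ≤ 2 * (Real.exp (|lam.im| * x) * Real.exp (-(|lam.im| * t))) * ‖V.coef 0 t‖ * ‖D t‖ := by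
        gcongr
    _ = _ := by ring

theorem exists_norm_fund_sub_rot_le {l : ℝ} (hl : 0 ≤ l) {ε : ℝ} (hε : 0 < ε) :
    ∃ R, ∀ lam : ℂ, R ≤ ‖lam‖ →
      ‖V.fund lam l - rot (-(lam * l))‖ ≤ ε * Real.exp (|lam.im| * l) := by
  set K := Real.exp (∫ t in (0 : ℝ)..l, 2 * ‖V.coef 0 t‖)
  have hK : 0 < K := Real.exp_pos _
  obtain ⟨R, hR⟩ := exists_norm_integral_rot_phase_mul_le (V.intervalIntegrable_coef 0) hl
    (div_pos hε hK)
  refine ⟨R, fun lam hlam => ?_⟩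
  have hD : Continuous fun t : ℝ => V.fund lam t - rot (-(lam * t)) :=
    (V.continuous_fund lam).sub (continuous_rot.comp (by fun_prop))
  have hgronwall := le_mul_exp_of_le_add_integral (ε := ε / K) (l := l)
    (w := fun x => Real.exp (-(|lam.im| * x)) * ‖V.fund lam x - rot (-(lam * x))‖)
    (fun s t => (V.intervalIntegrable_coef 0 s t).norm.const_mul 2) (fun t => by positivity)
    ((by fun_prop : Continuous fun x : ℝ => Real.exp (-(|lam.im| * x))).mul hD.norm)
    (fun x hx => ?_) l ⟨hl, le_rfl⟩
  · rwa [div_mul_cancel₀ _ hK.ne', Real.exp_neg, inv_mul_le_iff₀ (Real.exp_pos _),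
      mul_comm (Real.exp _)] at hgronwall
  · rw [Real.exp_neg, inv_mul_le_iff₀ (Real.exp_pos _), mul_add, mul_comm _ (ε / K),
      fund_sub_rot]
    exact (norm_add_le _ _).trans (add_le_add (hR lam hlam x hx)
      (V.norm_integral_rot_mul_coef_mul_le lam hD hx.1))

end Asymptotics

end DiracPotential

section EntireFunctions

theorem exists_differentiable_mul_eq {f g : ℂ → ℂ} (hf : Differentiable ℂ f)
    (hg : Differentiable ℂ g) (hg₀ : ∀ z, analyticOrderAt g z ≠ ⊤)
    (hfg : ∀ z, analyticOrderAt g z ≤ analyticOrderAt f z) :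
    ∃ F : ℂ → ℂ, Differentiable ℂ F ∧ ∀ z, F z * g z = f z := by
  have hm : MeromorphicOn (f / g) univ := fun z _ =>
    (hf.analyticAt z).meromorphicAt.div (hg.analyticAt z).meromorphicAt
  set F := toMeromorphicNFOn (f / g) univ
  have hF : ∀ z, AnalyticAt ℂ F z := fun z => by
    rw [← (meromorphicNFOn_toMeromorphicNFOn (f / g) univ
      (mem_univ z)).meromorphicOrderAt_nonneg_iff_analyticAt,
      meromorphicOrderAt_toMeromorphicNFOn hm (mem_univ z),
      meromorphicOrderAt_div (hf.analyticAt z).meromorphicAt (hg.analyticAt z).meromorphicAt,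
      (hf.analyticAt z).meromorphicOrderAt_eq, (hg.analyticAt z).meromorphicOrderAt_eq]
    have hle := hfg z
    lift analyticOrderAt g z to ℕ using hg₀ z with k
    cases hord : analyticOrderAt f z with
    | top => simp
    | coe m =>
      simp only [ENat.map_natCast]
      exact_mod_cast sub_nonneg.2 (Int.ofNat_le.2 (ENat.natCast_le_natCast.1 (hord ▸ hle)))
  refine ⟨F, fun z => (hF z).differentiableAt, fun z => ?_⟩
  have hne : ∀ᶠ w in 𝓝[≠] z, g w ≠ 0 :=
    (hg.analyticAt z).eventually_eq_zero_or_eventually_ne_zero.resolve_left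
      fun h => hg₀ z (analyticOrderAt_eq_top.2 h)
  have hev : (fun w => F w * g w) =ᶠ[𝓝[≠] z] f := by
    filter_upwards [hm.toMeromorphicNFOn_eq_self_on_nhdsNE (mem_univ z), hne] with w hw hw₀
    rw [show F w = (f / g) w from hw, Pi.div_apply, div_mul_cancel₀ _ hw₀]
  exact tendsto_nhds_unique_of_eventuallyEq
    (((hF z).continuousAt.mul hg.continuous.continuousAt).tendsto.mono_left nhdsWithin_le_nhds)
    (hf.continuous.continuousAt.tendsto.mono_left nhdsWithin_le_nhds) hev

theorem eq_zero_of_small_on_spheres {F : ℂ → ℂ} (hF : Differentiable ℂ F)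
    (h : ∀ ε > 0, ∀ R : ℝ, ∃ r ≥ R, ∀ z, ‖z‖ = r → ‖F z‖ ≤ ε) (z : ℂ) : F z = 0 := by
  refine norm_le_zero_iff.1 (le_of_forall_pos_le_add fun ε hε => ?_)
  obtain ⟨r, hr, hFr⟩ := h ε hε (‖z‖ + 1)
  have hr0 : r ≠ 0 := by linarith [norm_nonneg z]
  rw [zero_add]
  refine Complex.norm_le_of_forall_mem_frontier_norm_le
    (Metric.isBounded_ball (x := (0 : ℂ)) (r := r)) hF.diffContOnCl (fun w hw => ?_)
    (subset_closure (by rw [mem_ball_zero_iff]; linarith))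
  rw [frontier_ball _ hr0, mem_sphere_zero_iff_norm] at hw
  exact hFr w hw

theorem exists_differentiable_mul_eq_sq {n f : ℂ → ℂ} (hn : Differentiable ℂ n)
    (hf : Differentiable ℂ f) (hdouble : OnlyDoubleZeros f) (hzero : ∀ z, f z = 0 → n z = 0) :
    ∃ F : ℂ → ℂ, Differentiable ℂ F ∧ ∀ z, F z * f z = n z ^ 2 := by
  have hf0 : ∀ z, f z ≠ 0 → analyticOrderAt f z = 0 := fun z hz =>
    (hf.analyticAt z).analyticOrderAt_eq_zero.2 hz
  refine exists_differentiable_mul_eq (hn.pow 2) hf (fun z => ?_) fun z => ?_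
  · by_cases hz : f z = 0
    · rw [hdouble z hz]
      exact ENat.natCast_ne_top 2
    · rw [hf0 z hz]
      exact ENat.zero_ne_top
  · by_cases hz : f z = 0
    · have hone : 1 ≤ analyticOrderAt n z := by
        rw [Order.one_le_iff_ne_zero, (hn.analyticAt z).analyticOrderAt_ne_zero]
        exact hzero z hz
      rw [hdouble z hz, show (fun z => n z ^ 2) = n ^ 2 from rfl,
        analyticOrderAt_pow (hn.analyticAt z)]
      simpa using nsmul_le_nsmul_right hone 2
    · rw [hf0 z hz]
      exact zero_le

/-- The quotient `n ^ 2 / f` is entire and tends to zero along the circles of radius `r`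
(Hochstadt's argument). -/
theorem eq_zero_of_onlyDoubleZeros {n f : ℂ → ℂ} (hn : Differentiable ℂ n)
    (hf : Differentiable ℂ f) (hdouble : OnlyDoubleZeros f) (hzero : ∀ z, f z = 0 → n z = 0)
    {w : ℂ → ℝ} (hw : ∀ z, 0 < w z)
    (hnw : ∀ ε > 0, ∃ R : ℝ, ∀ z, R ≤ ‖z‖ → ‖n z‖ ≤ ε * w z)
    (hfw : ∀ R : ℝ, ∃ r ≥ R, ∀ z, ‖z‖ = r → w z ^ 2 ≤ 4 * ‖f z‖) (z : ℂ) : n z = 0 := by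
  obtain ⟨F, hF, hFf⟩ := exists_differentiable_mul_eq_sq hn hf hdouble hzero
  have hF0 : ∀ z, F z = 0 := eq_zero_of_small_on_spheres hF fun ε hε R => by
    obtain ⟨R₁, hR₁⟩ := hnw (Real.sqrt (ε / 4)) (Real.sqrt_pos.2 (by positivity))
    obtain ⟨r, hr, hfr⟩ := hfw (max R R₁)
    refine ⟨r, (le_max_left _ _).trans hr, fun z hz => ?_⟩
    have hnz : ‖n z‖ ^ 2 ≤ ε / 4 * w z ^ 2 := by
      have h := pow_le_pow_left₀ (norm_nonneg _)
        (hR₁ z (((le_max_right _ _).trans hr).trans hz.ge)) 2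
      rwa [mul_pow, Real.sq_sqrt (by positivity)] at h
    refine le_of_mul_le_mul_right ?_ (by linarith [hfr z hz, pow_pos (hw z) 2] : 0 < ‖f z‖)
    calc ‖F z‖ * ‖f z‖ = ‖n z‖ ^ 2 := by rw [← norm_mul, hFf z, norm_pow]
      _ ≤ ε / 4 * (4 * ‖f z‖) := hnz.trans (by gcongr; exact hfr z hz)
      _ = ε * ‖f z‖ := by ring
  have hn2 := hFf z
  rw [hF0, zero_mul] at hn2
  exact pow_eq_zero_iff two_ne_zero |>.1 hn2.symm

end EntireFunctions

section SineLowerBound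

theorem normSq_sin (z : ℂ) :
    Complex.normSq (Complex.sin z) = Real.cosh z.im ^ 2 - Real.cos z.re ^ 2 := by
  have h : Complex.sin z = (Real.sin z.re * Real.cosh z.im : ℝ) +
      (Real.cos z.re * Real.sinh z.im : ℝ) * Complex.I := by
    rw [Complex.sin_eq]
    push_cast
    ring
  rw [h, Complex.normSq_add_mul_I, mul_pow, mul_pow, Real.sin_sq, Real.cosh_sq]
  ring

theorem cos_sq_le_half_of_abs_sub_le {x : ℝ} {k : ℕ}
    (h : |x - (2 * k + 1) * (Real.pi / 2)| ≤ Real.pi / 4) : Real.cos x ^ 2 ≤ 1 / 2 := by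
  obtain ⟨hl, hr⟩ := abs_le.1 h
  have hcos : 0 ≤ Real.cos (2 * (x - (2 * k + 1) * (Real.pi / 2))) :=
    Real.cos_nonneg_of_mem_Icc ⟨by linarith, by linarith⟩
  have hx : 2 * x = 2 * (x - (2 * k + 1) * (Real.pi / 2)) + Real.pi + k * (2 * Real.pi) := by ring
  rw [Real.cos_sq, hx, Real.cos_add_nat_mul_two_pi, Real.cos_add_pi]
  linarith

theorem two_le_cosh_sq_of_one_le_abs {y : ℝ} (h : 1 ≤ |y|) : 2 ≤ Real.cosh y ^ 2 := by
  have hsinh : 1 ≤ |Real.sinh y| := by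
    rw [Real.abs_sinh]
    exact h.trans (Real.self_le_sinh_iff.2 (abs_nonneg y))
  rw [Real.cosh_sq]
  linarith [(one_le_sq_iff_one_le_abs _).2 hsinh]

/-- On circles midway between the zeros of the sine, either the real part is far from these zeros
or the imaginary part is large. -/
theorem cos_re_sq_le_of_norm_eq {z : ℂ} {k : ℕ} (h : ‖z‖ = (2 * k + 1) * (Real.pi / 2)) :
    Real.cos z.re ^ 2 ≤ Real.cosh z.im ^ 2 / 2 := by
  by_cases hre : (2 * k + 1 / 2) * (Real.pi / 2) ≤ |z.re|
  · have hcos : Real.cos |z.re| ^ 2 ≤ 1 / 2 :=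
      cos_sq_le_half_of_abs_sub_le (k := k)
        (abs_le.2 ⟨by linarith, by linarith [Complex.abs_re_le_norm z, Real.pi_pos]⟩)
    rw [Real.cos_abs] at hcos
    linarith [one_le_pow₀ (n := 2) (Real.one_le_cosh z.im)]
  · have him : 1 ≤ z.im ^ 2 := by
      have hz : z.re ^ 2 + z.im ^ 2 = ((2 * k + 1) * (Real.pi / 2)) ^ 2 := by
        rw [← h, ← Complex.normSq_eq_norm_sq, Complex.normSq_apply]
        ring
      have hre' := pow_le_pow_left₀ (abs_nonneg z.re) (not_le.1 hre).le 2
      rw [sq_abs] at hre'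
      have hpi : (9 : ℝ) / 4 ≤ (Real.pi / 2) ^ 2 := by nlinarith [Real.pi_gt_three]
      nlinarith [k.cast_nonneg (α := ℝ)]
    linarith [two_le_cosh_sq_of_one_le_abs ((one_le_sq_iff_one_le_abs _).1 him),
      Real.cos_sq_le_one z.re]

theorem exp_sq_le_normSq_sin {z : ℂ} {k : ℕ} (h : ‖z‖ = (2 * k + 1) * (Real.pi / 2)) :
    Real.exp |z.im| ^ 2 ≤ 8 * Complex.normSq (Complex.sin z) := by
  have hexp : Real.exp |z.im| ≤ 2 * Real.cosh z.im := by
    rw [← Real.cosh_abs, Real.cosh_eq]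
    linarith [Real.exp_pos (-|z.im|)]
  have hsq := pow_le_pow_left₀ (Real.exp_pos _).le hexp 2
  rw [normSq_sin]
  linarith [cos_re_sq_le_of_norm_eq h]

end SineLowerBound

/-- The orthogonal projection of the `2 × 2` matrices onto the line spanned by `J`. -/
def projJ : M2 →ₗ[ℂ] M2 :=
  (-(2 : ℂ)⁻¹ • (Matrix.traceLinearMap (Fin 2) ℂ ℂ).comp (LinearMap.mulLeft ℂ J)).smulRight J

theorem projJ_apply (A : M2) : projJ A = (-(2 : ℂ)⁻¹ * (J * A).trace) • J := rfl

theorem projJ_J : projJ J = J := by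
  rw [projJ_apply, J_mul_J, trace_neg, trace_one, Fintype.card_fin, Nat.cast_ofNat, neg_mul_neg,
    inv_mul_cancel₀ two_ne_zero, one_smul]

namespace DiracPotential

section Circles

variable (V : DiracPotential)

theorem exists_norm_map_fund_sub_rot_le {E : Type*} [NormedAddCommGroup E] [NormedSpace ℂ E]
    (L : M2 →ₗ[ℂ] E) {l : ℝ} (hl : 0 ≤ l) {ε : ℝ} (hε : 0 < ε) :
    ∃ R, ∀ lam : ℂ, R ≤ ‖lam‖ →
      ‖L (V.fund lam l) - L (rot (-(lam * l)))‖ ≤ ε * Real.exp (|lam.im| * l) := by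
  set C := ‖LinearMap.toContinuousLinearMap L‖ + 1
  have hC : 0 < C := by positivity
  obtain ⟨R, hR⟩ := V.exists_norm_fund_sub_rot_le hl (div_pos hε hC)
  refine ⟨R, fun lam hlam => ?_⟩
  rw [← map_sub]
  calc ‖L (V.fund lam l - rot (-(lam * l)))‖ ≤ C * ‖V.fund lam l - rot (-(lam * l))‖ :=
        (LinearMap.toContinuousLinearMap L).le_of_opNorm_le (le_add_of_nonneg_right zero_le_one) _
    _ ≤ C * (ε / C * Real.exp (|lam.im| * l)) := by gcongr; exact hR lam hlam
    _ = ε * Real.exp (|lam.im| * l) := by rw [← mul_assoc, mul_div_cancel₀ _ hC.ne']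

theorem exists_exp_sq_le_norm_disc_sub_two {l : ℝ} (hl : 0 < l) (R : ℝ) :
    ∃ r ≥ R, ∀ lam : ℂ, ‖lam‖ = r →
      Real.exp (|lam.im| * l) ^ 2 ≤ 4 * ‖V.disc (l + l) lam - 2‖ := by
  obtain ⟨R₁, hR₁⟩ := V.exists_norm_map_fund_sub_rot_le (Matrix.traceLinearMap (Fin 2) ℂ ℂ)
    (add_pos hl hl).le (by norm_num : (0 : ℝ) < 1 / 4)
  obtain ⟨k, hk⟩ := exists_nat_ge (max R R₁ * l)
  have hr : max R R₁ ≤ (2 * k + 1) * (Real.pi / 2) / l :=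
    (le_div_iff₀ hl).2 (by nlinarith [Real.pi_gt_three, k.cast_nonneg (α := ℝ)])
  refine ⟨_, (le_max_left _ _).trans hr, fun lam hlam => ?_⟩
  have hsin := exp_sq_le_normSq_sin (z := lam * l) (k := k) <| by
    rw [norm_mul, Complex.norm_real, Real.norm_of_nonneg hl.le, hlam, div_mul_cancel₀ _ hl.ne']
  have hnear := hR₁ lam (((le_max_right _ _).trans hr).trans hlam.ge)
  have hfree : 4 * Complex.sin (lam * l) ^ 2 = (V.fund lam (l + l)).trace -
      (rot (-(lam * (l + l : ℝ)))).trace - (V.disc (l + l) lam - 2) := by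
    rw [disc, trace_rot, Complex.cos_neg, Complex.ofReal_add, mul_add,
      ← two_mul (lam * l : ℂ), Complex.cos_two_mul, Complex.cos_sq']
    ring
  have htriangle := (congrArg norm hfree).le.trans (norm_sub_le _ _)
  rw [norm_mul, norm_pow, Complex.norm_ofNat, ← Complex.normSq_eq_norm_sq] at htriangle
  rw [traceLinearMap_apply, traceLinearMap_apply, mul_add |lam.im|, Real.exp_add, ← sq] at hnear
  rw [Complex.im_mul_ofReal, abs_mul, abs_of_pos hl] at hsin
  linarith

theorem exists_disc_ne_two {l : ℝ} (hl : 0 < l) : ∃ lam : ℂ, V.disc (l + l) lam ≠ 2 := by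
  obtain ⟨r, hr, hdisc⟩ := V.exists_exp_sq_le_norm_disc_sub_two hl 0
  refine ⟨r, fun h => ?_⟩
  have := hdisc r (by rw [Complex.norm_real, Real.norm_of_nonneg hr])
  rw [h, sub_self, norm_zero, mul_zero] at this
  exact this.not_gt (by positivity)

end Circles

section Comparison

variable (V : DiracPotential)

/-- The potential translated by `a`. -/
def shift (a : ℝ) : DiracPotential where
  p t := V.p (t + a)
  r t := V.r (t + a)
  p_int s t := by simpa using (V.p_int (s + a) (t + a)).comp_add_right a
  r_int s t := by simpa using (V.r_int (s + a) (t + a)).comp_add_right a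

theorem fund_add (lam : ℂ) (a t : ℝ) :
    V.fund lam (t + a) = (V.shift a).fund lam t * V.fund lam a := by
  have h := (V.shift a).eq_fund_mul (lam := lam) ((V.isIntegralOf_fund lam).comp_add_right a)
  simpa only [zero_add] using congrFun h t

/-- The comparison matrix of the transfer matrices of the Dirac system over `[0, l]` and
`[l, 2 * l]`; it vanishes where they are inverse to each other. -/
def comparison (l : ℝ) (lam : ℂ) : M2 :=
  ((V.shift l).fund lam l).adjugate - V.fund lam l

theorem comparison_eq (l : ℝ) (lam : ℂ) :
    V.comparison l lam = V.fund lam l * ((V.fund lam (l + l)).adjugate - 1) := by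
  rw [comparison, fund_add, adjugate_mul_distrib, mul_sub, ← mul_assoc, fund_mul_adjugate_fund,
    one_mul, mul_one]

theorem map_comparison (L : M2 →ₗ[ℂ] ℂ) (l : ℝ) (lam : ℂ) : L (V.comparison l lam) =
    (L.comp ((Matrix.traceLinearMap (Fin 2) ℂ ℂ).smulRight (1 : M2) - LinearMap.id))
      ((V.shift l).fund lam l) - L (V.fund lam l) := by
  rw [comparison, map_sub, adjugate_eq_trace_smul_one_sub]
  rfl

theorem exists_norm_map_comparison_le {L : M2 →ₗ[ℂ] ℂ} (hL : L J = 0) {l : ℝ} (hl : 0 ≤ l) {ε : ℝ}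
    (hε : 0 < ε) : ∃ R, ∀ lam : ℂ, R ≤ ‖lam‖ →
      ‖L (V.comparison l lam)‖ ≤ ε * Real.exp (|lam.im| * l) := by
  set L' := L.comp ((Matrix.traceLinearMap (Fin 2) ℂ ℂ).smulRight (1 : M2) - LinearMap.id)
  obtain ⟨R₁, hR₁⟩ := (V.shift l).exists_norm_map_fund_sub_rot_le L' hl (half_pos hε)
  obtain ⟨R₂, hR₂⟩ := V.exists_norm_map_fund_sub_rot_le L hl (half_pos hε)
  refine ⟨max R₁ R₂, fun lam hlam => ?_⟩
  have hrot (z : ℂ) : L' (rot z) = L (rot z) := by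
    change L ((rot z).trace • 1 - rot z) = L (rot z)
    rw [map_sub, map_smul, trace_rot, rot, map_add, map_smul, map_smul, hL]
    simp only [smul_eq_mul]
    ring
  calc ‖L (V.comparison l lam)‖ = ‖(L' ((V.shift l).fund lam l) - L' (rot (-(lam * l)))) -
        (L (V.fund lam l) - L (rot (-(lam * l))))‖ := by
        rw [map_comparison, hrot, sub_sub_sub_cancel_right]
    _ ≤ ε / 2 * Real.exp (|lam.im| * l) + ε / 2 * Real.exp (|lam.im| * l) :=
        (norm_sub_le _ _).trans (add_le_add (hR₁ lam ((le_max_left _ _).trans hlam))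
          (hR₂ lam ((le_max_right _ _).trans hlam)))
    _ = ε * Real.exp (|lam.im| * l) := by ring

variable {V} {l : ℝ}

theorem comparison_eq_zero_of_disc_eq_two (hl : 0 < l)
    (hV : OnlyDoubleZeros fun lam => V.disc (l + l) lam - 2) {lam : ℂ}
    (h : V.disc (l + l) lam = 2) : V.comparison l lam = 0 := by
  have hderiv : deriv (V.disc (l + l)) lam = 0 := by
    by_contra hne
    have horder := (((V.differentiable_disc (l + l)).sub_const 2).analyticAt
      lam).analyticOrderAt_eq_one_of_zero_deriv_ne_zero (sub_eq_zero.2 h) (by rwa [deriv_sub_const])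
    exact absurd ((hV lam (sub_eq_zero.2 h)).symm.trans horder) (by decide)
  rw [comparison_eq, V.fund_eq_one_of_deriv_disc_eq_zero (add_pos hl hl) h hderiv, adjugate_one,
    sub_self, mul_zero]

theorem map_comparison_eq_zero (hl : 0 < l)
    (hV : OnlyDoubleZeros fun lam => V.disc (l + l) lam - 2) {L : M2 →ₗ[ℂ] ℂ} (hL : L J = 0)
    (lam : ℂ) : L (V.comparison l lam) = 0 := by
  have hdiff : Differentiable ℂ fun lam => L (V.comparison l lam) := by
    simp only [map_comparison]
    exact ((V.shift l).differentiable_map_fund _ l).sub (V.differentiable_map_fund L l)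
  exact eq_zero_of_onlyDoubleZeros (w := fun lam => Real.exp (|lam.im| * l)) hdiff
    ((V.differentiable_disc (l + l)).sub_const 2) hV
    (fun lam h => by rw [comparison_eq_zero_of_disc_eq_two hl hV (sub_eq_zero.1 h), map_zero])
    (fun lam => Real.exp_pos _) (fun ε hε => V.exists_norm_map_comparison_le hL hl.le hε)
    (V.exists_exp_sq_le_norm_disc_sub_two hl) lam

theorem comparison_eq_projJ (hl : 0 < l)
    (hV : OnlyDoubleZeros fun lam => V.disc (l + l) lam - 2) (lam : ℂ) :
    V.comparison l lam = projJ (V.comparison l lam) := by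
  ext i j
  refine sub_eq_zero.1 (map_comparison_eq_zero hl hV
    (L := (Matrix.entryLinearMap ℂ ℂ i j).comp (LinearMap.id - projJ)) ?_ lam)
  rw [LinearMap.comp_apply, LinearMap.sub_apply, projJ_J, LinearMap.id_apply, sub_self, map_zero]

theorem shift_fund_period (hper : V.shift l = V) (lam : ℂ) (x : ℝ) :
    (V.shift x).fund lam l = V.fund lam x * V.fund lam l * (V.fund lam x).adjugate := by
  have h := V.fund_add lam l x
  rw [hper, add_comm, fund_add] at h
  rw [← h, mul_assoc, fund_mul_adjugate_fund, mul_one]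

theorem shift_disc (hper : V.shift l = V) (x : ℝ) : (V.shift x).disc l = V.disc l := by
  funext lam
  rw [disc, disc, shift_fund_period hper, trace_mul_comm, ← mul_assoc, adjugate_fund_mul_fund,
    one_mul]

theorem shift_comparison (hper : V.shift (l + l) = V) (lam : ℂ) (x : ℝ) :
    (V.shift x).comparison l lam = V.fund lam (x + l) *
      ((V.fund lam (l + l)).adjugate - 1) * (V.fund lam x).adjugate := by
  have hadj : (V.fund lam x).adjugate.adjugate = V.fund lam x := by
    simp [adjugate_fin_two, ← eta_fin_two]
  have hcancel : V.fund lam x * (V.fund lam x).adjugate = 1 := V.fund_mul_adjugate_fund lam x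
  have hK : (V.fund lam x * V.fund lam (l + l) * (V.fund lam x).adjugate).adjugate - 1 =
      V.fund lam x * ((V.fund lam (l + l)).adjugate - 1) * (V.fund lam x).adjugate := by
    rw [adjugate_mul_distrib, adjugate_mul_distrib, hadj, mul_sub, sub_mul, mul_one, hcancel,
      mul_assoc]
  rw [comparison_eq, shift_fund_period hper, hK, add_comm x, fund_add V lam x l]
  simp only [mul_assoc]

theorem isIntegralOf_shift_comparison (hper : V.shift (l + l) = V) (lam : ℂ) :
    IsIntegralOf (fun x => (V.shift x).comparison l lam) fun x =>
      V.coef lam (x + l) * (V.shift x).comparison l lam -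
        (V.shift x).comparison l lam * V.coef lam x := by
  have hadj (x : ℝ) : (V.coef lam x).adjugate = -V.coef lam x := by
    rw [adjugate_eq_trace_smul_one_sub, trace_coef, zero_smul, zero_sub]
  simp only [shift_comparison hper]
  convert (((V.isIntegralOf_fund lam).comp_add_right l).mul_const
    ((V.fund lam (l + l)).adjugate - 1)).mul (V.isIntegralOf_fund lam).adjugate using 2 with x
  rw [adjugate_mul_distrib, hadj]
  noncomm_ring

theorem det_comparison (lam : ℂ) : (V.comparison l lam).det = 2 - V.disc (l + l) lam := by
  rw [comparison_eq, det_mul, det_fund, det_sub_one, det_adjugate, det_fund,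
    adjugate_eq_trace_smul_one_sub, trace_sub, trace_smul, trace_one, disc, Fintype.card_fin,
    one_pow, smul_eq_mul]
  push_cast
  ring

theorem J_mul_coef_eq_of_comparison_eq_projJ (hper : V.shift (l + l) = V) {lam : ℂ}
    (hlam : V.disc (l + l) lam ≠ 2)
    (hJ : ∀ x, (V.shift x).comparison l lam = projJ ((V.shift x).comparison l lam)) :
    ∀ᵐ x, J * V.coef lam x = V.coef lam (x + l) * J := by
  have hE := isIntegralOf_shift_comparison hper lam
  have hprojE := hE.linearMap_comp (projJ.restrictScalars ℝ)
  simp only [LinearMap.restrictScalars_apply, ← hJ] at hprojE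
  filter_upwards [hE.ae_eq hprojE] with x hx
  set h := -(2 : ℂ)⁻¹ * (J * (V.shift x).comparison l lam).trace
  have hEx : (V.shift x).comparison l lam = h • J := hJ x
  have hh : h ≠ 0 := fun h0 => hlam <| by
    have hdet := (V.shift x).det_comparison (l := l) lam
    rw [hEx, h0, zero_smul, det_zero, shift_disc hper] at hdet
    exact (sub_eq_zero.1 hdet.symm).symm
  have htrace : (J * (V.coef lam (x + l) * J - J * V.coef lam x)).trace = 0 := by
    rw [mul_sub, trace_sub, trace_mul_comm, mul_assoc, ← mul_assoc J, J_mul_J, mul_neg_one,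
      neg_one_mul, trace_neg, trace_neg, trace_coef, trace_coef, sub_self]
  rw [hEx, Matrix.mul_smul, Matrix.smul_mul, ← smul_sub, projJ_apply, Matrix.mul_smul, trace_smul,
    htrace, smul_zero, mul_zero, zero_smul] at hx
  exact (sub_eq_zero.1 ((smul_eq_zero.1 hx).resolve_left hh)).symm

theorem antiperiodic_of_onlyDoubleZeros (hl : 0 < l) (hper : V.shift (l + l) = V)
    (hV : OnlyDoubleZeros fun lam => V.disc (l + l) lam - 2) :
    ∀ᵐ x, V.mat (x + l) = -V.mat x := by
  obtain ⟨lam, hlam⟩ := V.exists_disc_ne_two hl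
  have hcoef := J_mul_coef_eq_of_comparison_eq_projJ hper hlam fun x =>
    comparison_eq_projJ (V := V.shift x) hl (by rwa [shift_disc hper]) lam
  filter_upwards [hcoef] with x hx
  rw [coef, coef, ← mul_assoc, J_mul_J, neg_one_mul, neg_sub, mul_assoc J, sub_mul, V.mat_mul_J,
    Matrix.smul_mul, one_mul, mul_sub, mul_neg, ← mul_assoc, Matrix.mul_smul, J_mul_J, neg_one_mul,
    neg_neg, smul_neg, sub_neg_eq_add, add_comm, sub_eq_add_neg] at hx
  exact (add_left_cancel hx).symm

end Comparison

end DiracPotential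

section PhaseRotation

/-- The invertible matrices `exp (J (α 𝕀 + β σ₂)) = e^{-iβ} (cos α 𝕀 + sin α J)`, which commute
with `J`. -/
def phaseRot (α β : ℝ) : M2 := Complex.exp (-Complex.I * β) • rot α

theorem pauli2_eq : pauli2 = Complex.I • J := by
  ext i j
  fin_cases i <;> fin_cases j <;> simp [pauli2, J]

theorem J_mul_smul_one_add_smul_pauli2 (a b : ℂ) :
    J * (a • (1 : M2) + b • pauli2) = a • J + (-Complex.I * b) • (1 : M2) := by
  rw [pauli2_eq, mul_add, mul_smul_comm, mul_smul_comm, mul_smul_comm, mul_one, J_mul_J]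
  module

theorem J_mul_phaseRot (α β : ℝ) : J * phaseRot α β = phaseRot α β * J := by
  rw [phaseRot, mul_smul_comm, J_mul_rot, smul_mul_assoc]

theorem hasDerivAt_rot_ofReal (x : ℝ) : HasDerivAt (fun x : ℝ => rot x) (J * rot x) x := by
  simpa [Function.comp_def] using
    (hasDerivAt_rot (x : ℂ)).scomp x Complex.ofRealCLM.hasDerivAt

theorem continuous_rot_ofReal : Continuous fun x : ℝ => rot x :=
  continuous_rot.comp Complex.continuous_ofReal

theorem exp_smul_J (α : ℝ) : NormedSpace.exp (α • J) = rot α := by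
  have hexp : IsIntegralOf (fun x : ℝ => NormedSpace.exp (x • J))
      fun x => J * NormedSpace.exp (x • J) :=
    .of_hasDerivAt (fun x => hasDerivAt_exp_smul_const' J x) (by fun_prop)
  have hrot : IsIntegralOf (fun x : ℝ => rot x) fun x => J * rot x :=
    .of_hasDerivAt hasDerivAt_rot_ofReal (continuous_const.mul continuous_rot_ofReal)
  refine congrFun (hexp.eq_of_mul (fun _ _ => intervalIntegrable_const) hrot ?_) α
  simp [rot_zero]

theorem exp_J_mul_eq_phaseRot (α β : ℝ) :
    NormedSpace.exp (J * ((α : ℂ) • (1 : M2) + (β : ℂ) • pauli2)) = phaseRot α β := by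
  have hscalar : NormedSpace.exp ((-Complex.I * β) • (1 : M2))
      = Complex.exp (-Complex.I * β) • (1 : M2) := by
    rw [← Algebra.algebraMap_eq_smul_one, ← NormedSpace.algebraMap_exp_comm,
      ← Complex.exp_eq_exp_ℂ, Algebra.algebraMap_eq_smul_one]
  rw [J_mul_smul_one_add_smul_pauli2, NormedSpace.exp_add_of_commute
    ((Commute.one_right _).smul_right _), hscalar, Complex.coe_smul, exp_smul_J, mul_smul_comm,
    mul_one, phaseRot]

theorem isIntegralOf_phaseRot {α a β b : ℝ → ℝ} (hα : IsIntegralOf α a)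
    (hβ : IsIntegralOf β b) : IsIntegralOf (fun x => phaseRot (α x) (β x)) fun x =>
      J * ((a x : ℂ) • (1 : M2) + (b x : ℂ) • pauli2) * phaseRot (α x) (β x) := by
  have hphase (y : ℝ) : HasDerivAt (fun y : ℝ => Complex.exp (-Complex.I * y) • (1 : M2))
      ((-Complex.I * Complex.exp (-Complex.I * y)) • (1 : M2)) y := by
    have h := ((hasDerivAt_id (y : ℂ)).const_mul (-Complex.I)).cexp.comp_ofReal
    exact (h.congr_deriv (by rw [id, mul_one, mul_comm])).smul_const (1 : M2)
  have hβ' := hβ.comp_hasDerivAt hphase (by fun_prop)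
  have hα' := hα.comp_hasDerivAt hasDerivAt_rot_ofReal
    (continuous_const.mul continuous_rot_ofReal)
  convert hβ'.mul hα' using 2 with x x
  · rw [phaseRot, smul_one_mul]
  · simp only [J_mul_smul_one_add_smul_pauli2, phaseRot, add_mul, smul_mul_assoc, mul_smul_comm,
      one_mul, ← Complex.coe_smul, smul_smul]
    module

theorem matIntegral_smul_one_add_smul_pauli2 (a b : ℝ → ℝ) (z : ℝ) :
    matIntegral (fun t => (a t : ℂ) • (1 : M2) + (b t : ℂ) • pauli2) z
      = ((∫ t in (0 : ℝ)..z, a t : ℝ) : ℂ) • (1 : M2)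
        + ((∫ t in (0 : ℝ)..z, b t : ℝ) : ℂ) • pauli2 := by
  ext i j
  fin_cases i <;> fin_cases j <;>
    simp [matIntegral, pauli2, intervalIntegral.integral_ofReal]

end PhaseRotation

theorem onlyDoubleZeros_const_mul_comp_sub_iff {f : ℂ → ℂ} (hf : Differentiable ℂ f) {c : ℂ}
    (hc : c ≠ 0) (a : ℂ) :
    (OnlyDoubleZeros fun lam => c * f (lam - a)) ↔ OnlyDoubleZeros f := by
  have hsub : Differentiable ℂ fun lam : ℂ => lam - a := by fun_prop
  have hord (lam : ℂ) :
      analyticOrderAt (fun lam => c * f (lam - a)) lam = analyticOrderAt f (lam - a) := by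
    rw [show (fun lam => c * f (lam - a)) = (fun _ => c) * (f ∘ fun lam => lam - a) from rfl,
      analyticOrderAt_mul analyticAt_const ((hf.comp hsub).analyticAt lam),
      analyticAt_const.analyticOrderAt_eq_zero.2 hc, zero_add,
      analyticOrderAt_comp_of_deriv_ne_zero (hsub.analyticAt lam) (by simp)]
  simp only [OnlyDoubleZeros, hord, mul_eq_zero, hc, false_or]
  exact (Equiv.subRight a).forall_congr_left.trans (by simp)

/-- Hermitian, `π`-periodic and locally integrable coefficient matrices. -/
structure IsPeriodicHermitian (Q : ℝ → M2) : Prop where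
  isHermitian : ∀ x, (Q x).IsHermitian
  periodic : Function.Periodic Q Real.pi
  integrableOn : ∀ i j : Fin 2, IntegrableOn (fun x => Q x i j) (Ico 0 Real.pi) volume

/-- The coefficient `(q₁ + q₂) / 2` of the identity matrix in `Q`. -/
def scalarPart (Q : ℝ → M2) (x : ℝ) : ℝ := ((Q x 0 0).re + (Q x 1 1).re) / 2

/-- The coefficient `(q₁ - q₂) / 2` of `σ₃` in `Q`. -/
def diagonalPart (Q : ℝ → M2) (x : ℝ) : ℝ := ((Q x 0 0).re - (Q x 1 1).re) / 2

/-- The mean value of `(q₁ + q₂) / 2`, by which the gauge transformation shifts the spectral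
parameter. -/
def scalarMean (Q : ℝ → M2) : ℝ := Real.pi⁻¹ * ∫ t in (0 : ℝ)..Real.pi, scalarPart Q t

/-- The rotation angle of the gauge transformation `R`. -/
def angle (Q : ℝ → M2) (x : ℝ) : ℝ := ∫ t in (0 : ℝ)..x, (scalarPart Q t - scalarMean Q)

theorem angle_zero (Q : ℝ → M2) : angle Q 0 = 0 := integral_same

/-- The integral `∫₀ˣ Im q`, the phase accumulated by the fundamental matrix. -/
def imIntegral (Q : ℝ → M2) (x : ℝ) : ℝ := ∫ t in (0 : ℝ)..x, (Q t 0 1).im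

/-- The mean value of `Im q`. -/
def imMean (Q : ℝ → M2) : ℝ := Real.pi⁻¹ * imIntegral Q Real.pi

/-- The phase of the scalar factor of the gauge transformation `R`. -/
def imAngle (Q : ℝ → M2) (x : ℝ) : ℝ := ∫ t in (0 : ℝ)..x, ((Q t 0 1).im - imMean Q)

namespace IsPeriodicHermitian

variable {Q : ℝ → M2} (h : IsPeriodicHermitian Q)

include h

theorem intervalIntegrable_entry (i j : Fin 2) (a b : ℝ) :
    IntervalIntegrable (fun x => Q x i j) volume a b := by
  have hp : Function.Periodic (fun x => Q x i j) Real.pi := fun x => by simp only [h.periodic x]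
  refine hp.intervalIntegrable₀ Real.pi_ne_zero ?_ a b
  exact (intervalIntegrable_iff_integrableOn_Ico_of_le Real.pi_pos.le).2 (h.integrableOn i j)

theorem intervalIntegrable_re (i j : Fin 2) (a b : ℝ) :
    IntervalIntegrable (fun x => (Q x i j).re) volume a b :=
  ⟨(h.intervalIntegrable_entry i j a b).1.re, (h.intervalIntegrable_entry i j a b).2.re⟩

theorem intervalIntegrable_im (i j : Fin 2) (a b : ℝ) :
    IntervalIntegrable (fun x => (Q x i j).im) volume a b :=
  ⟨(h.intervalIntegrable_entry i j a b).1.im, (h.intervalIntegrable_entry i j a b).2.im⟩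

theorem intervalIntegrable_scalarPart (a b : ℝ) :
    IntervalIntegrable (scalarPart Q) volume a b :=
  ((h.intervalIntegrable_re 0 0 a b).add (h.intervalIntegrable_re 1 1 a b)).div_const 2

theorem intervalIntegrable_diagonalPart (a b : ℝ) :
    IntervalIntegrable (diagonalPart Q) volume a b :=
  ((h.intervalIntegrable_re 0 0 a b).sub (h.intervalIntegrable_re 1 1 a b)).div_const 2

theorem intervalIntegrable (a b : ℝ) : IntervalIntegrable Q volume a b :=
  intervalIntegrable_of_entry h.intervalIntegrable_entry a b

theorem intervalIntegrable_coef (lam : ℂ) (a b : ℝ) :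
    IntervalIntegrable (fun x => J * (Q x - lam • (1 : M2))) volume a b :=
  (((IsIntegralOf.integral h.intervalIntegrable).sub
    (.integral fun _ _ => intervalIntegrable_const)).const_mul J).intervalIntegrable a b

theorem diag_eq (x : ℝ) (i : Fin 2) : Q x i i = ((Q x i i).re : ℂ) :=
  (Complex.conj_eq_iff_re.1 ((h.isHermitian x).apply i i)).symm

theorem Q1_eq (x : ℝ) : Q1 Q x =
    !![(diagonalPart Q x : ℂ), (Q x 0 1).re; (Q x 0 1).re, -diagonalPart Q x] := by
  rw [Q1, h.diag_eq x 0, h.diag_eq x 1]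
  ext i j
  fin_cases i <;> fin_cases j <;> simp [pauli1, pauli3, diagonalPart]

theorem Q2_eq (x : ℝ) :
    Q2 Q x = (scalarPart Q x : ℂ) • (1 : M2) + ((Q x 0 1).im : ℂ) • pauli2 := by
  rw [Q2, h.diag_eq x 0, h.diag_eq x 1, scalarPart]
  push_cast
  rfl

theorem Q1_add_Q2 (x : ℝ) : Q1 Q x + Q2 Q x = Q x := by
  have h00 : (diagonalPart Q x + scalarPart Q x : ℂ) = Q x 0 0 := by
    rw [h.diag_eq x 0, diagonalPart, scalarPart]
    push_cast
    ring
  have h11 : (-diagonalPart Q x + scalarPart Q x : ℂ) = Q x 1 1 := by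
    rw [h.diag_eq x 1, diagonalPart, scalarPart]
    push_cast
    ring
  have h01 := Complex.re_add_im (Q x 0 1)
  have h10 : (Q x 0 1).re - (Q x 0 1).im * Complex.I = Q x 1 0 := by
    rw [← (h.isHermitian x).apply 1 0]
    apply Complex.ext <;> simp
  rw [h.Q1_eq, h.Q2_eq]
  ext i j
  fin_cases i <;> fin_cases j <;> simp [pauli2, ← sub_eq_add_neg, h00, h11, h01, h10]

theorem isIntegralOf_angle : IsIntegralOf (angle Q) fun x => scalarPart Q x - scalarMean Q :=
  .integral fun s t => (h.intervalIntegrable_scalarPart s t).sub intervalIntegrable_const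

theorem isIntegralOf_imIntegral : IsIntegralOf (imIntegral Q) fun x => (Q x 0 1).im :=
  .integral (h.intervalIntegrable_im 0 1)

theorem angle_pi : angle Q Real.pi = 0 := by
  rw [angle, integral_sub (h.intervalIntegrable_scalarPart _ _) intervalIntegrable_const,
    scalarMean, intervalIntegral.integral_const, sub_zero, smul_eq_mul,
    mul_inv_cancel_left₀ Real.pi_ne_zero, sub_self]

theorem periodic_angle : Function.Periodic (angle Q) Real.pi := fun x => by
  have hp : Function.Periodic (fun t => scalarPart Q t - scalarMean Q) Real.pi := fun t => by
    simp only [scalarPart, h.periodic t]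
  have hsub := h.isIntegralOf_angle.sub_eq x (x + Real.pi)
  rw [hp.intervalIntegral_add_eq x 0, zero_add] at hsub
  exact sub_eq_zero.1 (hsub.trans h.angle_pi)

theorem angle_add_half (hs : ∀ᵐ x : ℝ, scalarPart Q (x + Real.pi / 2) = scalarPart Q x) (x : ℝ) :
    angle Q (x + Real.pi / 2) = angle Q x := by
  have hshift : IsIntegralOf (fun x => angle Q (x + Real.pi / 2))
      fun x => scalarPart Q x - scalarMean Q :=
    (h.isIntegralOf_angle.comp_add_right (Real.pi / 2)).congr_ae <| by
      filter_upwards [hs] with x hx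
      rw [hx]
  have hadd (x : ℝ) : angle Q (x + Real.pi / 2) = angle Q (Real.pi / 2) + angle Q x := by
    rw [hshift.eq_add x, h.isIntegralOf_angle.eq_add x, angle_zero, zero_add, zero_add]
  have hhalf := hadd (Real.pi / 2)
  rw [add_halves, h.angle_pi] at hhalf
  linarith [hadd x]

theorem meanQ2_eq :
    meanQ2 Q = (scalarMean Q : ℂ) • (1 : M2) + (imMean Q : ℂ) • pauli2 := by
  rw [meanQ2, funext h.Q2_eq, matIntegral_smul_one_add_smul_pauli2, smul_add, smul_smul,
    smul_smul, scalarMean, imMean, imIntegral]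
  push_cast
  rfl

theorem R_eq (z : ℝ) : R Q z = phaseRot (angle Q z) (imAngle Q z) := by
  have hsub : (fun t => Q2 Q t - meanQ2 Q) = fun t =>
      ((scalarPart Q t - scalarMean Q : ℝ) : ℂ) • (1 : M2)
        + (((Q t 0 1).im - imMean Q : ℝ) : ℂ) • pauli2 := by
    funext t
    rw [h.Q2_eq, h.meanQ2_eq]
    push_cast
    module
  rw [R, hsub, matIntegral_smul_one_add_smul_pauli2]
  exact exp_J_mul_eq_phaseRot _ _

theorem intervalIntegrable_trig_mul_add (a b : ℝ) {c s : ℝ → ℝ} (hc : Continuous c)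
    (hs : Continuous s) : IntervalIntegrable
      (fun x => c (angle Q x) * diagonalPart Q x + s (angle Q x) * (Q x 0 1).re) volume a b :=
  ((h.intervalIntegrable_diagonalPart a b).continuousOn_mul
    (hc.comp h.isIntegralOf_angle.continuous).continuousOn).add
  ((h.intervalIntegrable_re 0 1 a b).continuousOn_mul
    (hs.comp h.isIntegralOf_angle.continuous).continuousOn)

/-- The gauge transformed potential `Q̃₁ = R⁻¹ Q₁ R`; see `Q1tilde_eq`. -/
def potential : DiracPotential where
  p x := Real.cos (2 * angle Q x) * diagonalPart Q x + -Real.sin (2 * angle Q x) * (Q x 0 1).re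
  r x := Real.sin (2 * angle Q x) * diagonalPart Q x + Real.cos (2 * angle Q x) * (Q x 0 1).re
  p_int a b := h.intervalIntegrable_trig_mul_add a b (c := fun y => Real.cos (2 * y))
    (s := fun y => -Real.sin (2 * y)) (by fun_prop) (by fun_prop)
  r_int a b := h.intervalIntegrable_trig_mul_add a b (c := fun y => Real.sin (2 * y))
    (s := fun y => Real.cos (2 * y)) (by fun_prop) (by fun_prop)

theorem rot_angle_mul_potential (x : ℝ) :
    rot (angle Q x) * h.potential.mat x = Q1 Q x * rot (angle Q x) := by
  have hcs := Complex.cos_sq_add_sin_sq (angle Q x : ℂ)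
  rw [h.Q1_eq, DiracPotential.mat, potential, rot]
  ext i j
  fin_cases i <;> fin_cases j <;>
    simp [J, Matrix.mul_apply, Fin.sum_univ_two, Complex.cos_two_mul, Complex.sin_two_mul]
  · linear_combination (2 * Complex.cos (angle Q x) * diagonalPart Q x) * hcs
  · linear_combination (2 * Complex.cos (angle Q x) * (Q x 0 1).re) * hcs
  · linear_combination (2 * Complex.cos (angle Q x) * (Q x 0 1).re) * hcs
  · linear_combination (-2 * Complex.cos (angle Q x) * diagonalPart Q x) * hcs

theorem phaseRot_angle_mul_potential (x β : ℝ) :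
    phaseRot (angle Q x) β * h.potential.mat x = Q1 Q x * phaseRot (angle Q x) β := by
  rw [phaseRot, smul_mul_assoc, mul_smul_comm, h.rot_angle_mul_potential]

theorem Q1tilde_eq (z : ℝ) : Q1tilde Q z = h.potential.mat z := by
  have hR : IsUnit (R Q z).det := (isUnit_iff_isUnit_det _).1 (isUnit_exp _)
  have hconj : Q1 Q z * R Q z = R Q z * h.potential.mat z := by
    rw [h.R_eq, h.phaseRot_angle_mul_potential]
  rw [Q1tilde, mul_assoc, hconj, nonsing_inv_mul_cancel_left _ _ hR]

theorem shift_potential : h.potential.shift Real.pi = h.potential := by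
  simp only [potential, DiracPotential.shift, h.periodic_angle _, diagonalPart, h.periodic _]

theorem potential_antiperiodic (h1 : ∀ᵐ x : ℝ, Q1 Q (x + Real.pi / 2) = -Q1 Q x)
    (h2 : ∀ᵐ x : ℝ, Q2 Q (x + Real.pi / 2) = Q2 Q x) :
    ∀ᵐ x : ℝ, h.potential.mat (x + Real.pi / 2) = -h.potential.mat x := by
  have hs : ∀ᵐ x : ℝ, scalarPart Q (x + Real.pi / 2) = scalarPart Q x := by
    filter_upwards [h2] with x hx
    have h00 := congrFun (congrFun hx 0) 0
    rw [h.Q2_eq, h.Q2_eq] at h00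
    simpa [pauli2] using h00
  have hmat (x : ℝ) : h.potential.mat x = rot (-angle Q x) * (Q1 Q x * rot (angle Q x)) := by
    rw [← h.rot_angle_mul_potential, ← mul_assoc, rot_neg_mul_rot, one_mul]
  filter_upwards [h1] with x hx
  rw [hmat, hmat, h.angle_add_half hs, hx, neg_mul, mul_neg]

/-- The fundamental matrix of `J Y' + Q Y = lam Y` in terms of that of the gauge transformed
system; see `fundamentalMatrix_eq`. -/
def gaugedFund (lam : ℂ) (x : ℝ) : M2 :=
  phaseRot (angle Q x) (imIntegral Q x) * h.potential.fund (lam - scalarMean Q) x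

theorem gaugedFund_zero (lam : ℂ) : h.gaugedFund lam 0 = 1 := by
  simp [gaugedFund, phaseRot, angle_zero, imIntegral, rot_zero, DiracPotential.fund_zero]

theorem isIntegralOf_gaugedFund (lam : ℂ) : IsIntegralOf (h.gaugedFund lam) fun x =>
    J * (Q x - lam • (1 : M2)) * h.gaugedFund lam x := by
  have hrot := isIntegralOf_phaseRot h.isIntegralOf_angle h.isIntegralOf_imIntegral
  refine (hrot.mul (h.potential.isIntegralOf_fund (lam - scalarMean Q))).congr_ae
    (.of_forall fun x => ?_)
  set G := phaseRot (angle Q x) (imIntegral Q x)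
  have hG : G * h.potential.coef (lam - scalarMean Q) x
      = J * (Q1 Q x - (lam - scalarMean Q) • (1 : M2)) * G := by
    rw [DiracPotential.coef, ← mul_assoc, ← J_mul_phaseRot, mul_assoc, mul_sub,
      h.phaseRot_angle_mul_potential, mul_smul_comm, mul_one, mul_assoc, sub_mul, smul_one_mul]
  have hsum : J * (((scalarPart Q x - scalarMean Q : ℝ) : ℂ) • (1 : M2)
        + ((Q x 0 1).im : ℂ) • pauli2) + J * (Q1 Q x - (lam - scalarMean Q) • (1 : M2))
      = J * (Q x - lam • (1 : M2)) := by
    rw [← mul_add]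
    conv_rhs => rw [← h.Q1_add_Q2 x, h.Q2_eq]
    congr 1
    push_cast
    module
  rw [← mul_assoc G, hG, ← add_mul, ← add_mul, hsum, mul_assoc]
  rfl

theorem isFundamentalMatrix_gaugedFund (lam : ℂ) :
    IsFundamentalMatrix Q lam (h.gaugedFund lam) where
  absolutelyContinuous i j :=
    (isIntegralOf_iff_entry.1 (h.isIntegralOf_gaugedFund lam) i j).absolutelyContinuousOnInterval
  equation := by
    have hderiv : ∀ᵐ x : ℝ, ∀ i j, HasDerivAt (fun t => h.gaugedFund lam t i j)
        ((J * (Q x - lam • (1 : M2)) * h.gaugedFund lam x) i j) x := by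
      simp only [ae_all_iff]
      exact fun i j => (isIntegralOf_iff_entry.1 (h.isIntegralOf_gaugedFund lam) i j).ae_hasDerivAt
    filter_upwards [hderiv] with x hx
    refine ⟨_, hx, ?_⟩
    rw [← mul_assoc, ← mul_assoc, J_mul_J, neg_one_mul, neg_sub, sub_mul, sub_add_cancel,
      smul_one_mul]
  initial := h.gaugedFund_zero lam

theorem isIntegralOf_of_isFundamentalMatrix {lam : ℂ} {Y : ℝ → M2}
    (hY : IsFundamentalMatrix Q lam Y) :
    IsIntegralOf Y fun x => J * (Q x - lam • (1 : M2)) * Y x := by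
  have hint (i j : Fin 2) (a b : ℝ) :
      IntervalIntegrable (fun x => (J * (Q x - lam • (1 : M2)) * Y x) i j) volume a b := by
    have hcoef := IsIntegralOf.integral (h.intervalIntegrable_coef lam)
    have hprod (k : Fin 2) : IntervalIntegrable
        (fun x => (J * (Q x - lam • (1 : M2))) i k * Y x k j) volume a b :=
      ((isIntegralOf_iff_entry.1 hcoef i k).intervalIntegrable a b).mul_continuousOn
        (hY.absolutelyContinuous k j a b).continuousOn
    simp only [Matrix.mul_apply (M := J * _), Fin.sum_univ_two]
    exact (hprod 0).add (hprod 1)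
  refine isIntegralOf_iff_entry.2 fun i j =>
    .of_absolutelyContinuous (hY.absolutelyContinuous i j) ?_ (hint i j)
  filter_upwards [hY.equation] with x ⟨Y', hderiv, hequation⟩
  have hY' : Y' = J * (Q x - lam • (1 : M2)) * Y x := by
    rw [mul_assoc, sub_mul, smul_one_mul, ← hequation, sub_add_cancel_right, mul_neg, ← mul_assoc,
      J_mul_J, neg_one_mul, neg_neg]
  exact hY' ▸ hderiv i j

theorem fundamentalMatrix_eq (lam : ℂ) : fundamentalMatrix Q lam = h.gaugedFund lam := by
  have hY : IsFundamentalMatrix Q lam (fundamentalMatrix Q lam) :=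
    Classical.epsilon_spec ⟨_, h.isFundamentalMatrix_gaugedFund lam⟩
  exact (h.isIntegralOf_of_isFundamentalMatrix hY).eq_of_mul (h.intervalIntegrable_coef lam)
    (h.isIntegralOf_gaugedFund lam) (hY.initial.trans (h.gaugedFund_zero lam).symm)

theorem discriminant_eq (lam : ℂ) : discriminant Q lam =
    Complex.exp (-Complex.I * imIntegral Q Real.pi)
      * h.potential.disc Real.pi (lam - scalarMean Q) := by
  rw [discriminant, h.fundamentalMatrix_eq lam, gaugedFund, h.angle_pi, phaseRot,
    Complex.ofReal_zero, rot_zero, smul_one_mul, trace_smul, smul_eq_mul, DiracPotential.disc]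

theorem onlyDoubleZeros_iff :
    (OnlyDoubleZeros fun lam => discriminant Q lam
      - 2 * Complex.exp (-Complex.I * (∫ t in (0 : ℝ)..Real.pi, (Q t 0 1).im : ℝ))) ↔
    OnlyDoubleZeros fun lam => h.potential.disc Real.pi lam - 2 := by
  rw [← onlyDoubleZeros_const_mul_comp_sub_iff
    ((h.potential.differentiable_disc Real.pi).sub_const 2)
    (Complex.exp_ne_zero (-Complex.I * imIntegral Q Real.pi)) (scalarMean Q)]
  simp only [h.discriminant_eq, mul_sub, mul_comm _ (2 : ℂ), imIntegral]

end IsPeriodicHermitian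

end

end SelfAdjointSystem

theorem theorem5p2 (Q : ℝ → Matrix (Fin 2) (Fin 2) ℂ)
    (hHerm : ∀ x, (Q x).IsHermitian)
    (hper : Function.Periodic Q Real.pi)
    (hint : ∀ i j : Fin 2, IntegrableOn (fun x => Q x i j) (Set.Ico 0 Real.pi) volume) :
    ((∀ᵐ x : ℝ, SelfAdjointSystem.Q1 Q (x + Real.pi / 2) = -SelfAdjointSystem.Q1 Q x) →
      (∀ᵐ x : ℝ, SelfAdjointSystem.Q2 Q (x + Real.pi / 2) = SelfAdjointSystem.Q2 Q x) →
      SelfAdjointSystem.OnlyDoubleZeros (fun lam => SelfAdjointSystem.discriminant Q lam -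
        2 * Complex.exp (-Complex.I * ((∫ t in (0 : ℝ)..Real.pi, (Q t 0 1).im : ℝ) : ℂ)))) ∧
    (SelfAdjointSystem.OnlyDoubleZeros (fun lam => SelfAdjointSystem.discriminant Q lam -
        2 * Complex.exp (-Complex.I * ((∫ t in (0 : ℝ)..Real.pi, (Q t 0 1).im : ℝ) : ℂ))) →
      (∀ᵐ x : ℝ,
        SelfAdjointSystem.Q1tilde Q (x + Real.pi / 2) = -SelfAdjointSystem.Q1tilde Q x) ∧
      (∀ᵐ x : ℝ,
        SelfAdjointSystem.Q2tilde Q (x + Real.pi / 2) = SelfAdjointSystem.Q2tilde Q x)) := by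
  have h : SelfAdjointSystem.IsPeriodicHermitian Q := ⟨hHerm, hper, hint⟩
  rw [h.onlyDoubleZeros_iff]
  refine ⟨fun hQ1 hQ2 => ?_, fun hzeros => ⟨?_, .of_forall fun _ => rfl⟩⟩
  · have := h.potential.onlyDoubleZeros_of_antiperiodic Real.pi_div_two_pos
      (h.potential_antiperiodic hQ1 hQ2)
    rwa [add_halves] at this
  · rw [← add_halves Real.pi] at hzeros
    simp only [h.Q1tilde_eq]
    exact SelfAdjointSystem.DiracPotential.antiperiodic_of_onlyDoubleZeros Real.pi_div_two_pos
      (by rw [add_halves, h.shift_potential]) hzeros
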